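/- Let $a:[0,1]\to\mathbb R$ be continuous and non-negative, with $a\ge a_0>0$ on an interval $[c,d]\subseteq[0,1]$, $c<d$, where $c=0$ or $d=1$ (hypothesis $(H_1)$), and let $A$ be an upper bound of $a$ on $[0,1]$. For $p\in(1,2)$ let $$Y_p=\big(W^{2,p}(0,1)\cap W^{1,p}_0(0,1)\big)\times W^{1,p}_0(0,1).$$ For $(z_0,z_1)\in Y_p$, a strong solution of $$z_{tt}-z_{xx}+a(x)z_t=0\ \text{ on } \mathbb R_+\times(0,1),\qquad z(t,0)=z(t,1)=0,\qquad z(0,\cdot)=z_0,\quad z_t(0,\cdot)=z_1$$ is a function $z\in L^\infty(\mathbb R_+,W^{2,p}(0,1)\cap W^{1,p}_0(0,1))\cap W^{1,\infty}(\mathbb R_+,W^{1,p}_0(0,1))$ such that, for all $t\ge 0$ and $x\in[0,1]$, $$z(t,x)=\tfrac12\big[\tilde z_0(x+t)+\tilde z_0(x-t)\big]+\tfrac12\int_{x-t}^{x+t}\tilde z_1(s)\,ds-\tfrac12\int_0^t\int_{x-(t-s)}^{x+(t-s)}\tilde a(y)\,\tilde z_t(s,y)\,dy\,ds,$$ where $\tilde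 z_0,\tilde z_1,\tilde z_t(s,\cdot)$ are the $2$-periodic extensions of the odd extensions to $[-1,1]$, and $\tilde a$ is the $2$-periodic extension of the even extension of $a$ to $[-1,1]$. Put $\rho=z_x+z_t$, $\xi=z_x-z_t$ and $$E_p(t)=\frac1p\int_0^1\big(|\rho|^p+|\xi|^p\big)\,dx,\qquad G(y)=\frac{(|y|+1)^p-1}{p}-|y|,\qquad \mathcal E_p(t)=\int_0^1\big(G(\rho)+G(\xi)\big)\,dx .$$ Proposition. There are positive constants $C_p$, depending only on $p$, and $C$, depending only on $A,a_0,c,d$ (and not on $p$), such that for every $p\in(1,2)$, every $a$ as above, every $(z_0,z_1)\in Y_p$ and every strong solution $z$ starting at $(z_0,z_1)$ with $E_p(0)\le 1$, $$\int_S^T\mathcal E_p(t)\,dt\le C\,C_p\,\mathcal E_p(S)\qquad\text{for all } 0\le S\le T,$$ where the integrals defining $\mathcal E_p(t)$, $t\ge0$, and $\int_S^T\mathcal E_p(t)\,dt$ are integrals of integrable functions. -/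

import Mathlib

open Set MeasureTheory
open scoped ENNReal NNReal

namespace DampedWave

noncomputable section

/-- Lebesgue measure on the open unit interval. -/
def unitMeasure : Measure ℝ := volume.restrict (Ioo (0 : ℝ) 1)

/-- Space derivative of a function on `[0,1]` (one-sided at the end points). -/
def dx (u : ℝ → ℝ) : ℝ → ℝ := derivWithin u (Icc 0 1)

/-- `W^{1,p}(0,1)`. A Sobolev function of one variable is identified with its continuous
representative: it is absolutely continuous on `[0,1]` and its (a.e. defined) derivative, which is
its weak derivative, lies in `L^p(0,1)`. Values outside `[0,1]` play no role. -/
def W1 (p : ℝ) : Set (ℝ → ℝ) :=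
  {u | AbsolutelyContinuousOnInterval u 0 1 ∧ MemLp (dx u) (ENNReal.ofReal p) unitMeasure}

/-- `W^{1,p}_0(0,1)`: the functions of `W^{1,p}(0,1)` that vanish at both end points. -/
def W10 (p : ℝ) : Set (ℝ → ℝ) := {u | u ∈ W1 p ∧ u 0 = 0 ∧ u 1 = 0}

/-- `W^{2,p}(0,1)`: `u` and `u'` lie in `W^{1,p}(0,1)`. -/
def W2 (p : ℝ) : Set (ℝ → ℝ) := {u | u ∈ W1 p ∧ dx u ∈ W1 p}

/-- The usual norm of `W^{1,p}(0,1)`. -/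
def normW1 (p : ℝ) (u : ℝ → ℝ) : ℝ≥0∞ :=
  eLpNorm u (ENNReal.ofReal p) unitMeasure + eLpNorm (dx u) (ENNReal.ofReal p) unitMeasure

/-- The usual norm of `W^{2,p}(0,1)`. -/
def normW2 (p : ℝ) (u : ℝ → ℝ) : ℝ≥0∞ :=
  normW1 p u + eLpNorm (dx (dx u)) (ENNReal.ofReal p) unitMeasure

/-- `Y_p = (W^{2,p}(0,1) ∩ W^{1,p}_0(0,1)) × W^{1,p}_0(0,1)`. -/
def Y (p : ℝ) : Set ((ℝ → ℝ) × (ℝ → ℝ)) := (W2 p ∩ W10 p) ×ˢ W10 p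

/-- `f ∈ L^∞(ℝ₊, X)` for a separable space `X` of functions on `(0,1)` with norm `nrm`, which
embeds in some `L^p(0,1)`: `f` is measurable (as a function of `(t,x)`, which for such `X` is the
same as strong measurability of `t ↦ f t`), and `‖f t‖_X` is essentially bounded. -/
def MemLinfty (X : Set (ℝ → ℝ)) (nrm : (ℝ → ℝ) → ℝ≥0∞) (f : ℝ → ℝ → ℝ) : Prop :=
  AEStronglyMeasurable (fun q : ℝ × ℝ => f q.1 q.2)
    ((volume.restrict (Ioi (0 : ℝ))).prod unitMeasure) ∧
  ∃ M : ℝ≥0, ∀ᵐ t ∂(volume.restrict (Ioi (0 : ℝ))), f t ∈ X ∧ nrm (f t) ≤ M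

/-- `z_x(t,x)`, for `x ∈ [0,1]`. -/
def zx (z : ℝ → ℝ → ℝ) (t x : ℝ) : ℝ := dx (z t) x

/-- `z_t(t,x)`, for `t ≥ 0` (one-sided at `t = 0`). -/
def zt (z : ℝ → ℝ → ℝ) (t x : ℝ) : ℝ := derivWithin (fun s => z s x) (Ici 0) t

/-- The `2`-periodic extension to `ℝ` of the odd extension to `[-1,1]` of a function on `[0,1]`. -/
def oddExt (f : ℝ → ℝ) (x : ℝ) : ℝ :=
  if 2 * Int.fract (x / 2) ≤ 1 then f (2 * Int.fract (x / 2))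
  else -f (2 - 2 * Int.fract (x / 2))

/-- The `2`-periodic extension to `ℝ` of the even extension to `[-1,1]` of a function on `[0,1]`. -/
def evenExt (f : ℝ → ℝ) (x : ℝ) : ℝ :=
  if 2 * Int.fract (x / 2) ≤ 1 then f (2 * Int.fract (x / 2))
  else f (2 - 2 * Int.fract (x / 2))

/-- `z` (a function of `t ≥ 0` and `x ∈ [0,1]`) is the strong solution of
`z_tt - z_xx + a z_t = 0`, `z(t,0) = z(t,1) = 0`, `z(0,·) = z₀`, `z_t(0,·) = z₁`:
`z ∈ L^∞(ℝ₊, W^{2,p} ∩ W^{1,p}_0) ∩ W^{1,∞}(ℝ₊, W^{1,p}_0)` is given by d'Alembert's formula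
with source term `-ã z_t`. -/
structure IsStrongSolution (p : ℝ) (a z₀ z₁ : ℝ → ℝ) (z : ℝ → ℝ → ℝ) : Prop where
  /-- `z ∈ L^∞(ℝ₊, W^{2,p} ∩ W^{1,p}_0)` -/
  memLinfty : MemLinfty (W2 p ∩ W10 p) (normW2 p) z
  /-- `z_t ∈ L^∞(ℝ₊, W^{1,p}_0)` -/
  memLinfty_zt : MemLinfty (W10 p) (normW1 p) (zt z)
  /-- `z` is a primitive in time of `z_t`, so that `z_t` is its weak time derivative -/
  primitive : ∀ t, 0 ≤ t → ∀ x ∈ Icc (0 : ℝ) 1, z t x = z 0 x + ∫ s in (0 : ℝ)..t, zt z s x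
  /-- d'Alembert's formula -/
  formula : ∀ t, 0 ≤ t → ∀ x ∈ Icc (0 : ℝ) 1,
    z t x = (1 / 2) * (oddExt z₀ (x + t) + oddExt z₀ (x - t))
      + (1 / 2) * (∫ y in (x - t)..(x + t), oddExt z₁ y)
      + (1 / 2) * ∫ s in (0 : ℝ)..t, ∫ y in (x - (t - s))..(x + (t - s)),
          -(evenExt a y * oddExt (zt z s) y)

/-- Riemann invariant `ρ = z_x + z_t`. -/
def rho (z : ℝ → ℝ → ℝ) (t x : ℝ) : ℝ := zx z t x + zt z t x

/-- Riemann invariant `ξ = z_x - z_t`. -/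
def xi (z : ℝ → ℝ → ℝ) (t x : ℝ) : ℝ := zx z t x - zt z t x

/-- The `p`-th energy `E_p`. -/
def energy (p : ℝ) (z : ℝ → ℝ → ℝ) (t : ℝ) : ℝ :=
  (1 / p) * ∫ x in (0 : ℝ)..1, (|rho z t x| ^ p + |xi z t x| ^ p)

/-- `G(y) = ((|y| + 1)^p - 1) / p - |y|`. -/
def G (p y : ℝ) : ℝ := (1 / p) * ((|y| + 1) ^ p - 1) - |y|

/-- The modified energy `𝓔_p`. -/
def modEnergy (p : ℝ) (z : ℝ → ℝ → ℝ) (t : ℝ) : ℝ :=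
  ∫ x in (0 : ℝ)..1, (G p (rho z t x) + G p (xi z t x))

/-- Hypothesis (H₁) with its parameters: `a` is continuous and non-negative on `[0,1]`, and
`a ≥ a₀ > 0` on a non-degenerate interval `[c,d] ⊆ [0,1]` with `c = 0` or `d = 1`. -/
structure HypH1 (a : ℝ → ℝ) (a₀ c d : ℝ) : Prop where
  continuousOn : ContinuousOn a (Icc 0 1)
  nonneg : ∀ x ∈ Icc (0 : ℝ) 1, 0 ≤ a x
  a₀_pos : 0 < a₀
  c_nonneg : 0 ≤ c
  c_lt_d : c < d
  d_le_one : d ≤ 1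
  endpoint : c = 0 ∨ d = 1
  lower_bound : ∀ x ∈ Icc c d, a₀ ≤ a x

end

end DampedWave

/-! The Riemann invariants are glued into one function `R` on the circle of length 2: `R t x` is ρ
and `R t (-x)` is ξ for `x` in `[0,1]`. The boundary conditions become periodicity and zero mean,
and the wave equation becomes one transport equation `R_t - R_x = -(b/2)(R(t,x) - R(t,-x))`, with
`b` the even extension of `a`. The modified energy is the integral of `G p (R t x)` over the circle.
Working with `R` separates the analysis from the regularity questions, which are confined to
`IsStrongSolution.exists_reflectedTransport`.

Energy identity: the modular energy decreases at the rate `b (g(R) - g(R⁻))(R - R⁻) / 4` integrated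
over the circle, where `g = G'` is increasing and `R⁻` is the reflection of `R`
(`modularEnergy_eq`).

Observability (`exists_observability_const`): the initial energy is at most `K` times the integral
of `b G(R - R⁻)` over a time 2. Along a characteristic `R` changes only through the damping, so
where `b ≥ a₀` the initial value at `t + x` is compared with that at `t - x`. This controls the
translates of `R 0` by `2x` for `x` in an interval, hence by all small steps, hence by all steps;
zero mean and Jensen then control `R 0`. Only convexity and `G(l y) ≤ l² G(y)` for `l ≥ 1` are used,
so `K` does not involve `p`.

Closing: `G(R - R⁻)` is at most the dissipation density times a multiple of `1/((p-1)ε)`, plus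
`ε(G(R) + G(R⁻))` (`G_sub_le_dissipation`). With `ε` small depending on `A` and `K`, the last term
is absorbed and `E(t) ≤ κ(E(t) - E(t+2))`. Integrating in `t` telescopes and gives the bound `2κ
E(S)`, with `κ` a multiple of `1/(p-1)`. -/

namespace DampedWave

noncomputable section

/-! ### Convexity and growth of `G` -/

/-- The derivative `y ↦ sign(y) ((|y| + 1)^(p-1) - 1)` of `G p`. -/
def gDeriv (p y : ℝ) : ℝ := SignType.sign y * ((|y| + 1) ^ (p - 1) - 1)

theorem gDeriv_neg (p y : ℝ) : gDeriv p (-y) = -gDeriv p y := by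
  simp [gDeriv, Left.sign_neg]

theorem gDeriv_of_nonneg {p y : ℝ} (hy : 0 ≤ y) : gDeriv p y = (y + 1) ^ (p - 1) - 1 := by
  rcases hy.eq_or_lt with rfl | hy
  · simp [gDeriv]
  · simp [gDeriv, sign_pos hy, abs_of_pos hy]

theorem G_neg (p y : ℝ) : G p (-y) = G p y := by simp [G]

theorem G_abs (p y : ℝ) : G p |y| = G p y := by simp [G]

theorem G_zero (p : ℝ) : G p 0 = 0 := by simp [G]

theorem G_of_nonneg {p y : ℝ} (hy : 0 ≤ y) : G p y = (1 / p) * ((y + 1) ^ p - 1) - y := by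
  simp [G, abs_of_nonneg hy]

theorem continuous_G {p : ℝ} (hp : 0 < p) : Continuous (G p) := by
  unfold G
  have : Continuous fun y : ℝ => (|y| + 1) ^ p :=
    (continuous_abs.add continuous_const).rpow_const fun y => Or.inr hp.le
  fun_prop

/-- Symmetry transfers the derivative to the negative half-line; at the origin it is recovered as
the limit of the derivatives nearby. This avoids differentiating `|y|` at 0. -/
theorem hasDerivAt_of_even {f f' : ℝ → ℝ} (hf : ∀ y, f (-y) = f y)
    (hf' : ∀ y, f' (-y) = -f' y) (hpos : ∀ y, 0 < y → HasDerivAt f (f' y) y)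
    (hc : Continuous f) (hc' : Continuous f') (y : ℝ) : HasDerivAt f (f' y) y := by
  have hneg : ∀ y, y < 0 → HasDerivAt f (f' y) y := by
    intro y hy
    have h := (hpos (-y) (by linarith)).comp y (hasDerivAt_neg y)
    have e : f ∘ Neg.neg = f := funext hf
    rw [e, hf'] at h
    simpa using h
  rcases lt_trichotomy y 0 with h | rfl | h
  · exact hneg y h
  · refine hasDerivAt_of_hasDerivAt_of_ne (x := 0) (fun z hz => ?_) hc.continuousAt hc'.continuousAt
    rcases hz.lt_or_gt with h | h
    · exact hneg z h
    · exact hpos z h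
  · exact hpos y h

theorem hasDerivAt_of_odd {f f' : ℝ → ℝ} (hf : ∀ y, f (-y) = -f y)
    (hf' : ∀ y, f' (-y) = f' y) (hpos : ∀ y, 0 < y → HasDerivAt f (f' y) y)
    (hc : Continuous f) (hc' : Continuous f') (y : ℝ) : HasDerivAt f (f' y) y := by
  have hneg : ∀ y, y < 0 → HasDerivAt f (f' y) y := by
    intro y hy
    have h := ((hpos (-y) (by linarith)).comp y (hasDerivAt_neg y)).neg
    have e : -(f ∘ Neg.neg) = f := funext fun z => by simp [hf]
    rw [e, hf'] at h
    simpa using h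
  rcases lt_trichotomy y 0 with h | rfl | h
  · exact hneg y h
  · refine hasDerivAt_of_hasDerivAt_of_ne (x := 0) (fun z hz => ?_) hc.continuousAt hc'.continuousAt
    rcases hz.lt_or_gt with h | h
    · exact hneg z h
    · exact hpos z h
  · exact hpos y h

theorem continuous_gDeriv {p : ℝ} (hp : 1 < p) : Continuous (gDeriv p) := by
  -- Splitting into positive and negative parts removes the discontinuous sign.
  have e : gDeriv p = fun y => (max y 0 + 1) ^ (p - 1) - (max (-y) 0 + 1) ^ (p - 1) := by
    funext y
    rcases le_total 0 y with hy | hy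
    · rw [gDeriv_of_nonneg hy, max_eq_left hy, max_eq_right (by linarith)]
      simp
    · have := gDeriv_neg p y
      rw [gDeriv_of_nonneg (by linarith)] at this
      rw [max_eq_right hy, max_eq_left (by linarith)]
      simp
      linarith
  rw [e]
  have h : ∀ u : ℝ → ℝ, Continuous u → Continuous fun y => (u y) ^ (p - 1) := fun u hu =>
    hu.rpow_const fun y => Or.inr (by linarith)
  exact (h _ (by fun_prop)).sub (h _ (by fun_prop))

theorem hasDerivAt_G {p : ℝ} (hp : 1 < p) (y : ℝ) : HasDerivAt (G p) (gDeriv p y) y := by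
  refine hasDerivAt_of_even (G_neg p) (gDeriv_neg p) (fun y hy => ?_)
    (continuous_G (by linarith)) (continuous_gDeriv hp) y
  have h1 : HasDerivAt (fun y : ℝ => (1 / p) * ((y + 1) ^ p - 1) - y)
      ((1 / p) * (1 * p * (y + 1) ^ (p - 1)) - 1) y :=
    (((((hasDerivAt_id y).add_const 1).rpow_const (p := p)
      (Or.inl (by simp; linarith))).sub_const 1).const_mul (1 / p)).sub (hasDerivAt_id y)
  have hpne : p ≠ 0 := by linarith
  have e : (1 / p) * (1 * p * (y + 1) ^ (p - 1)) - 1 = gDeriv p y := by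
    rw [gDeriv_of_nonneg hy.le]; field_simp
  rw [e] at h1
  refine h1.congr_of_eventuallyEq ?_
  filter_upwards [lt_mem_nhds hy] with z hz
  exact G_of_nonneg hz.le

theorem hasDerivAt_gDeriv {p : ℝ} (hp : 1 < p) (y : ℝ) :
    HasDerivAt (gDeriv p) ((p - 1) * (|y| + 1) ^ (p - 2)) y := by
  refine hasDerivAt_of_odd (f' := fun y => (p - 1) * (|y| + 1) ^ (p - 2)) (gDeriv_neg p)
    (fun y => by simp) (fun y hy => ?_) (continuous_gDeriv hp) ?_ y
  · have h1 : HasDerivAt (fun y : ℝ => (y + 1) ^ (p - 1) - 1)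
        (1 * (p - 1) * (y + 1) ^ (p - 1 - 1)) y :=
      (((hasDerivAt_id y).add_const 1).rpow_const (p := p - 1)
        (Or.inl (by simp; linarith))).sub_const 1
    have e : 1 * (p - 1) * (y + 1) ^ (p - 1 - 1) = (p - 1) * (|y| + 1) ^ (p - 2) := by
      rw [abs_of_pos hy, one_mul]; congr 2; ring
    rw [e] at h1
    refine h1.congr_of_eventuallyEq ?_
    filter_upwards [lt_mem_nhds hy] with z hz
    exact gDeriv_of_nonneg hz.le
  · exact continuous_const.mul ((continuous_abs.add continuous_const).rpow_const fun y =>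
      Or.inl (add_pos_of_nonneg_of_pos (abs_nonneg y) one_pos).ne')

theorem monotone_gDeriv {p : ℝ} (hp : 1 < p) : Monotone (gDeriv p) := by
  refine monotone_of_deriv_nonneg (fun y => (hasDerivAt_gDeriv hp y).differentiableAt) fun y => ?_
  rw [(hasDerivAt_gDeriv hp y).deriv]
  have : 0 < p - 1 := by linarith
  positivity

theorem convexOn_G {p : ℝ} (hp : 1 < p) : ConvexOn ℝ univ (G p) := by
  refine Monotone.convexOn_univ_of_deriv (fun y => (hasDerivAt_G hp y).differentiableAt) ?_
  have : deriv (G p) = gDeriv p := funext fun y => (hasDerivAt_G hp y).deriv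
  rw [this]
  exact monotone_gDeriv hp

theorem G_nonneg {p : ℝ} (hp : 1 < p) (y : ℝ) : 0 ≤ G p y := by
  have h := one_add_mul_self_le_rpow_one_add (s := |y|) (by linarith [abs_nonneg y]) hp.le
  unfold G
  rw [add_comm |y| 1]
  have hp0 : 0 < p := by linarith
  have : (1 / p) * (p * |y|) ≤ (1 / p) * ((1 + |y|) ^ p - 1) := by gcongr; linarith
  have e : (1 / p) * (p * |y|) = |y| := by field_simp
  linarith

theorem G_mul_le {p : ℝ} (hp : 1 < p) {θ : ℝ} (h0 : 0 ≤ θ) (h1 : θ ≤ 1) (y : ℝ) :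
    G p (θ * y) ≤ θ * G p y := by
  have := (convexOn_G hp).2 (mem_univ y) (mem_univ 0) h0 (sub_nonneg.2 h1) (by ring)
  simpa [G_zero] using this

theorem G_le_G {p : ℝ} (hp : 1 < p) {x y : ℝ} (h : |x| ≤ |y|) : G p x ≤ G p y := by
  rcases (abs_nonneg y).eq_or_lt with h0 | h0
  · have hx : x = 0 := abs_eq_zero.1 (le_antisymm (h.trans h0.ge) (abs_nonneg x))
    rw [hx, G_zero]; exact G_nonneg hp y
  · rw [← G_abs p x, ← G_abs p y]
    have hθ : |x| / |y| ≤ 1 := (div_le_one h0).2 h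
    have := G_mul_le hp (div_nonneg (abs_nonneg x) h0.le) hθ |y|
    rw [div_mul_cancel₀ _ h0.ne'] at this
    exact this.trans (mul_le_of_le_one_left (G_nonneg hp _) hθ)

/-- Concavity of `s ↦ s^(p-1)` at `y + 1`, a convex combination of `l y + 1` and `1` with weights
`1/l` and `1 - 1/l`. -/
theorem gDeriv_mul_le {p : ℝ} (hp : p ∈ Ioo (1 : ℝ) 2) {l y : ℝ} (hl : 1 ≤ l) (hy : 0 ≤ y) :
    gDeriv p (l * y) ≤ l * gDeriv p y := by
  have hl0 : 0 < l := by linarith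
  rw [gDeriv_of_nonneg hy, gDeriv_of_nonneg (by positivity)]
  have h := (Real.concaveOn_rpow (p := p - 1) (by linarith [hp.1]) (by linarith [hp.2])).2
    (mem_Ici.2 (by positivity : 0 ≤ l * y + 1)) (mem_Ici.2 zero_le_one)
    (by positivity : 0 ≤ 1 / l) (sub_nonneg.2 ((div_le_one hl0).2 hl)) (by ring)
  simp only [smul_eq_mul, Real.one_rpow] at h
  have e : 1 / l * (l * y + 1) + (1 - 1 / l) * 1 = y + 1 := by field_simp; ring
  rw [e] at h
  have := mul_le_mul_of_nonneg_left h hl0.le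
  have e2 : l * (1 / l * (l * y + 1) ^ (p - 1) + (1 - 1 / l) * 1)
      = (l * y + 1) ^ (p - 1) + l - 1 := by field_simp; ring
  rw [e2] at this
  linarith

/-- Growth at most quadratic, uniformly in `p`: the derivative of `l² G(z) - G(l z)` is `l (l g(z) -
g(l z))`, which is nonnegative for `z > 0`. This keeps the observability constant free of `p`. -/
theorem G_mul_le_sq {p : ℝ} (hp : p ∈ Ioo (1 : ℝ) 2) {l : ℝ} (hl : 1 ≤ l) (y : ℝ) :
    G p (l * y) ≤ l ^ 2 * G p y := by
  suffices H : ∀ y, 0 ≤ y → G p (l * y) ≤ l ^ 2 * G p y by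
    have := H |y| (abs_nonneg y)
    rwa [G_abs, ← G_abs, abs_mul, abs_abs, ← abs_mul, G_abs] at this
  intro y hy
  have hd : ∀ z, HasDerivAt (fun z => l ^ 2 * G p z - G p (l * z))
      (l ^ 2 * gDeriv p z - gDeriv p (l * z) * l) z := fun z =>
    ((hasDerivAt_G hp.1 z).const_mul _).sub
      ((hasDerivAt_G hp.1 (l * z)).comp z (by simpa using (hasDerivAt_id z).const_mul l))
  have hm : MonotoneOn (fun z => l ^ 2 * G p z - G p (l * z)) (Ici 0) := by
    refine monotoneOn_of_deriv_nonneg (convex_Ici 0)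
      (fun z _ => (hd z).continuousAt.continuousWithinAt)
      (fun z _ => (hd z).differentiableAt.differentiableWithinAt) fun z hz => ?_
    rw [(hd z).deriv]
    rw [interior_Ici] at hz
    have := gDeriv_mul_le hp hl (mem_Ioi.1 hz).le
    nlinarith
  have := hm (mem_Ici.2 le_rfl) (mem_Ici.2 hy) hy
  simp only [mul_zero, G_zero, sub_zero] at this
  linarith

/-- Midpoint convexity gives a factor 1/2 and scaling by 2 a factor 4. -/
theorem G_add_le {p : ℝ} (hp : p ∈ Ioo (1 : ℝ) 2) (x y : ℝ) :
    G p (x + y) ≤ 2 * (G p x + G p y) := by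
  have h := (convexOn_G hp.1).2 (mem_univ x) (mem_univ y)
    (by norm_num : (0 : ℝ) ≤ 1 / 2) (by norm_num : (0 : ℝ) ≤ 1 / 2) (by norm_num)
  simp only [smul_eq_mul] at h
  have h2 := G_mul_le_sq hp (l := 2) (by norm_num) (1 / 2 * x + 1 / 2 * y)
  have e : 2 * (1 / 2 * x + 1 / 2 * y) = x + y := by ring
  rw [e] at h2
  linarith

theorem G_sub_le {p : ℝ} (hp : p ∈ Ioo (1 : ℝ) 2) (x y : ℝ) :
    G p (x - y) ≤ 2 * (G p x + G p y) := by
  have := G_add_le hp x (-y)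
  rwa [G_neg, ← sub_eq_add_neg] at this

theorem G_add_three_le {p : ℝ} (hp : p ∈ Ioo (1 : ℝ) 2) (x y z : ℝ) :
    G p (x + y + z) ≤ 4 * (G p x + G p y + G p z) := by
  have h1 := G_add_le hp (x + y) z
  have h2 := G_add_le hp x y
  have := G_nonneg hp.1 z
  linarith

/-- Strong monotonicity of the derivative of `G p` on bounded sets. -/
theorem gDeriv_strong_mono {p : ℝ} (hp : p ∈ Ioo (1 : ℝ) 2) {m x y : ℝ} (hx : |x| ≤ m)
    (hy : |y| ≤ m) :
    (p - 1) * (m + 1) ^ (p - 2) * (x - y) ^ 2 ≤ (gDeriv p x - gDeriv p y) * (x - y) := by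
  wlog hxy : y ≤ x generalizing x y
  · have := this hy hx (le_of_not_ge hxy)
    nlinarith
  have key := Convex.mul_sub_le_image_sub_of_le_deriv (convex_Icc (-m) m) (f := gDeriv p)
    (C := (p - 1) * (m + 1) ^ (p - 2)) (continuous_gDeriv hp.1).continuousOn
    (fun z _ => (hasDerivAt_gDeriv hp.1 z).differentiableAt.differentiableWithinAt)
    (fun z hz => ?_) y (abs_le.1 hy) x (abs_le.1 hx) hxy
  · nlinarith [mul_le_mul_of_nonneg_right key (sub_nonneg.2 hxy)]
  · rw [(hasDerivAt_gDeriv hp.1 z).deriv]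
    have hz' := interior_subset hz
    have : |z| ≤ m := abs_le.2 hz'
    refine mul_le_mul_of_nonneg_left ?_ (by linarith [hp.1])
    exact Real.rpow_le_rpow_of_nonpos (by positivity) (by linarith) (by linarith [hp.2])

/-- The mean value theorem bounds `G p y` by `|y| g(|y|)`, and `(|y|+1)^(p-2) ≤ 1` makes `g(|y|)` at
most `|y| (|y|+1)^(p-2)`. This weight matches the one in `gDeriv_strong_mono`. -/
theorem G_le_sq_mul {p : ℝ} (hp : p ∈ Ioo (1 : ℝ) 2) (y : ℝ) :
    G p y ≤ y ^ 2 * (|y| + 1) ^ (p - 2) := by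
  have hc := (convexOn_G hp.1)
  have h0 : (0 : ℝ) ≤ |y| := abs_nonneg y
  have h1 : G p |y| ≤ |y| * gDeriv p |y| := by
    have := Convex.image_sub_le_mul_sub_of_deriv_le (convex_Icc 0 |y|) (f := G p)
      (C := gDeriv p |y|) (continuous_G (by linarith [hp.1])).continuousOn
      (fun z _ => (hasDerivAt_G hp.1 z).differentiableAt.differentiableWithinAt)
      (fun z hz => by
        rw [(hasDerivAt_G hp.1 z).deriv]
        exact monotone_gDeriv hp.1 (interior_subset hz).2)
      0 (left_mem_Icc.2 h0) |y| (right_mem_Icc.2 h0) h0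
    rw [G_zero] at this
    linarith
  rw [G_abs, gDeriv_of_nonneg h0] at h1
  have h2 : (|y| + 1) ^ (p - 1) = (|y| + 1) ^ (p - 2) * (|y| + 1) := by
    rw [← Real.rpow_add_one (by positivity)]; congr 1; ring
  have h3 : (|y| + 1) ^ (p - 2) ≤ 1 :=
    Real.rpow_le_one_of_one_le_of_nonpos (by linarith) (by linarith [hp.2])
  rw [h2] at h1
  have h4 : |y| * ((|y| + 1) ^ (p - 2) * (|y| + 1) - 1) ≤ |y| * (|y| * (|y| + 1) ^ (p - 2)) := by
    gcongr; linarith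
  rw [← sq_abs]
  linarith

/-- The modular of a difference is controlled by the dissipation, up to a small multiple of the
modulars. -/
theorem G_sub_le_dissipation {p : ℝ} (hp : p ∈ Ioo (1 : ℝ) 2) {ε : ℝ} (h0 : 0 < ε) (h1 : ε ≤ 1)
    (x y : ℝ) :
    G p (x - y) ≤ 1 / ((p - 1) * ε) * ((gDeriv p x - gDeriv p y) * (x - y))
      + ε * (G p x + G p y) := by
  have hp1 : 0 < p - 1 := by linarith [hp.1]
  set m := max |x| |y| with hm
  have hx : |x| ≤ m := le_max_left _ _
  have hy : |y| ≤ m := le_max_right _ _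
  have hm0 : 0 ≤ m := (abs_nonneg x).trans hx
  have hs := gDeriv_strong_mono hp hx hy
  have hdis : 0 ≤ (gDeriv p x - gDeriv p y) * (x - y) := le_trans (by positivity) hs
  have hGm : G p m ≤ G p x + G p y := by
    have := G_nonneg hp.1 x
    have := G_nonneg hp.1 y
    rcases max_choice |x| |y| with h | h <;> rw [hm, h, G_abs] <;> linarith
  have hG := G_nonneg hp.1
  -- If `x` and `y` are relatively close, convexity yields the small factor `ε`; otherwise strong
  -- monotonicity of `g` takes over.
  rcases le_total |x - y| (ε * m) with h | h
  · have h2 : G p (x - y) ≤ ε * G p m := by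
      refine (G_le_G hp.1 (y := ε * m) ?_).trans (G_mul_le hp.1 h0.le h1 m)
      rwa [abs_of_nonneg (by positivity : 0 ≤ ε * m)]
    have h3 : ε * G p m ≤ ε * (G p x + G p y) := by gcongr
    have : 0 ≤ 1 / ((p - 1) * ε) * ((gDeriv p x - gDeriv p y) * (x - y)) := by positivity
    linarith
  · have h2 := G_le_sq_mul hp (x - y)
    -- Here `|x - y| + 1 ≥ ε (m + 1)`, and `ε^(2-p) ≥ ε` because `2 - p < 1`.
    have h3 : ε * (|x - y| + 1) ^ (p - 2) ≤ (m + 1) ^ (p - 2) := by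
      have a1 : (ε⁻¹ * (|x - y| + 1)) ^ (p - 2) ≤ (m + 1) ^ (p - 2) := by
        refine Real.rpow_le_rpow_of_nonpos (by positivity) ?_ (by linarith [hp.2])
        rw [← div_eq_inv_mul, le_div_iff₀ h0]
        nlinarith
      refine le_trans ?_ a1
      rw [Real.mul_rpow (by positivity) (by positivity)]
      gcongr
      rw [Real.inv_rpow h0.le, ← Real.rpow_neg h0.le]
      calc ε = ε ^ (1 : ℝ) := (Real.rpow_one ε).symm
        _ ≤ ε ^ (-(p - 2)) := Real.rpow_le_rpow_of_exponent_ge h0 h1 (by linarith [hp.1])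
    have h4 : (x - y) ^ 2 * (|x - y| + 1) ^ (p - 2)
        ≤ 1 / ((p - 1) * ε) * ((p - 1) * (m + 1) ^ (p - 2) * (x - y) ^ 2) := by
      have e : 1 / ((p - 1) * ε) * ((p - 1) * (m + 1) ^ (p - 2) * (x - y) ^ 2)
          = (x - y) ^ 2 * ((m + 1) ^ (p - 2) / ε) := by field_simp
      rw [e]
      gcongr
      rw [le_div_iff₀ h0]; linarith
    have h5 : 1 / ((p - 1) * ε) * ((p - 1) * (m + 1) ^ (p - 2) * (x - y) ^ 2)
        ≤ 1 / ((p - 1) * ε) * ((gDeriv p x - gDeriv p y) * (x - y)) := by gcongr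
    have : 0 ≤ ε * (G p x + G p y) := mul_nonneg h0.le (add_nonneg (hG x) (hG y))
    linarith

/-! ### Jensen's inequality and integrals over a period -/

/-- Jensen's inequality for `G p` on an interval of length two. -/
theorem G_average_le {p : ℝ} (hp : 1 < p) {u : ℝ → ℝ} (hu : Continuous u) (a : ℝ) :
    G p ((1 / 2) * ∫ s in a..(a + 2), u s) ≤ (1 / 2) * ∫ s in a..(a + 2), G p (u s) := by
  have hG := continuous_G (p := p) (by linarith)
  have h := (convexOn_G hp).map_set_average_le (μ := volume) (t := Ioc a (a + 2)) (f := u)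
    hG.continuousOn isClosed_univ (by simp) (by simp) (by simp)
    ((hu.integrableOn_Icc (a := a) (b := a + 2)).mono_set Ioc_subset_Icc_self)
    (((hG.comp hu).integrableOn_Icc (a := a) (b := a + 2)).mono_set Ioc_subset_Icc_self)
  have hab : a ≤ a + 2 := by linarith
  have e := fun v : ℝ → ℝ => interval_average_eq v a (a + 2)
  simp only [uIoc_of_le hab, add_sub_cancel_left, smul_eq_mul] at e
  rw [e, e] at h
  simpa only [one_div] using h

theorem intervalIntegral_swap_of_continuous {F : ℝ → ℝ → ℝ} (hF : Continuous (Function.uncurry F))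
    (a b c d : ℝ) :
    ∫ x in a..b, ∫ y in c..d, F x y = ∫ y in c..d, ∫ x in a..b, F x y := by
  refine intervalIntegral_intervalIntegral_swap ?_
  refine IntegrableOn.mono_set ?_ (prod_mono uIoc_subset_uIcc uIoc_subset_uIcc)
  exact hF.continuousOn.integrableOn_compact (isCompact_uIcc.prod isCompact_uIcc)

theorem integral_periodic_add {φ : ℝ → ℝ} (hφ : Function.Periodic φ 2) (s : ℝ) :
    ∫ x in (-1 : ℝ)..1, φ (x + s) = ∫ x in (-1 : ℝ)..1, φ x := by
  rw [intervalIntegral.integral_comp_add_right]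
  have := hφ.intervalIntegral_add_eq (-1 + s) (-1)
  convert this using 2 <;> ring

theorem integral_periodic_sub {φ : ℝ → ℝ} (hφ : Function.Periodic φ 2) (s : ℝ) :
    ∫ x in (-1 : ℝ)..1, φ (x - s) = ∫ x in (-1 : ℝ)..1, φ x := by
  simpa [sub_eq_add_neg] using integral_periodic_add hφ (-s)

theorem integral_zero_two_eq {φ : ℝ → ℝ} (hφ : Function.Periodic φ 2) :
    ∫ x in (0 : ℝ)..2, φ x = ∫ x in (-1 : ℝ)..1, φ x := by
  have := hφ.intervalIntegral_add_eq 0 (-1)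
  convert this using 2 <;> ring

theorem integral_symm_neg (φ : ℝ → ℝ) :
    ∫ x in (-1 : ℝ)..1, φ (-x) = ∫ x in (-1 : ℝ)..1, φ x := by
  rw [intervalIntegral.integral_comp_neg]; simp

/-! ### The reflected transport equation and its energy identity -/

/-- The source term of the reflected transport equation. -/
def src (b : ℝ → ℝ) (R : ℝ → ℝ → ℝ) (s y : ℝ) : ℝ := -(b y * (R s y - R s (-y)) / 2)

/-- `R` is a continuous `2`-periodic mild solution, for `t ≥ 0`, of
`R_t(t,x) - R_x(t,x) = -b(x)/2 (R(t,x) - R(t,-x))`, with vanishing mean. -/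
structure IsReflectedTransport (b : ℝ → ℝ) (R : ℝ → ℝ → ℝ) : Prop where
  b_cont : Continuous b
  b_nonneg : ∀ y, 0 ≤ b y
  b_even : ∀ y, b (-y) = b y
  b_per : Function.Periodic b 2
  cont : Continuous (Function.uncurry R)
  per : ∀ t, Function.Periodic (R t) 2
  eqn : ∀ t, 0 ≤ t → ∀ σ, R t (σ - t) = R 0 σ + ∫ s in (0 : ℝ)..t, src b R s (σ - s)
  mean : ∫ x in (-1 : ℝ)..1, R 0 x = 0

/-- The modular energy of a solution of the reflected transport equation. -/
def modularEnergy (p : ℝ) (R : ℝ → ℝ → ℝ) (t : ℝ) : ℝ := ∫ x in (-1 : ℝ)..1, G p (R t x)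

/-- The dissipation rate of the modular energy. -/
def dissipation (p : ℝ) (b : ℝ → ℝ) (R : ℝ → ℝ → ℝ) (t : ℝ) : ℝ :=
  (1 / 4) * ∫ x in (-1 : ℝ)..1,
    b x * ((gDeriv p (R t x) - gDeriv p (R t (-x))) * (R t x - R t (-x)))

namespace IsReflectedTransport

variable {b : ℝ → ℝ} {R : ℝ → ℝ → ℝ}

theorem cont_comp (h : IsReflectedTransport b R) {X : Type*} [TopologicalSpace X] {u v : X → ℝ}
    (hu : Continuous u) (hv : Continuous v) : Continuous fun x => R (u x) (v x) :=
  h.cont.comp (hu.prodMk hv)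

theorem src_cont (h : IsReflectedTransport b R) {X : Type*} [TopologicalSpace X] {u v : X → ℝ}
    (hu : Continuous u) (hv : Continuous v) : Continuous fun x => src b R (u x) (v x) := by
  unfold src
  exact (((h.b_cont.comp hv).mul
    ((h.cont_comp hu hv).sub (h.cont_comp hu hv.neg))).div_const 2).neg

theorem src_per (h : IsReflectedTransport b R) (s : ℝ) : Function.Periodic (src b R s) 2 := by
  intro y
  unfold src
  have e : -(y + 2) = -y - 2 := by ring
  rw [h.b_per y, h.per s y, e, (h.per s).sub_eq]

theorem src_neg (h : IsReflectedTransport b R) (s y : ℝ) : src b R s (-y) = -src b R s y := by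
  unfold src
  rw [h.b_even, neg_neg]; ring

theorem integral_src (h : IsReflectedTransport b R) (s : ℝ) :
    ∫ y in (-1 : ℝ)..1, src b R s y = 0 := by
  have := integral_symm_neg (src b R s)
  simp only [h.src_neg, intervalIntegral.integral_neg] at this
  linarith

theorem eqn_sub (h : IsReflectedTransport b R) {S t : ℝ} (hS : 0 ≤ S) (ht : 0 ≤ t) (σ : ℝ) :
    R t (σ - t) = R S (σ - S) + ∫ s in S..t, src b R s (σ - s) := by
  have hc : Continuous fun s => src b R s (σ - s) := h.src_cont continuous_id (by fun_prop)
  rw [h.eqn t ht, h.eqn S hS, ← intervalIntegral.integral_add_adjacent_intervals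
    (hc.intervalIntegrable 0 S) (hc.intervalIntegrable S t)]
  ring

/-- Transport preserves the integral over a period, and the source is odd in space, so it
contributes nothing. -/
theorem mean_eq (h : IsReflectedTransport b R) {t : ℝ} (ht : 0 ≤ t) :
    ∫ x in (-1 : ℝ)..1, R t x = 0 := by
  have hR0 : Continuous fun σ => R 0 σ := h.cont_comp continuous_const continuous_id
  have hc : Continuous (Function.uncurry fun σ s => src b R s (σ - s)) :=
    h.src_cont continuous_snd (by fun_prop)
  rw [← integral_periodic_sub (h.per t) t]
  simp only [h.eqn t ht]
  rw [intervalIntegral.integral_add (hR0.intervalIntegrable _ _)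
    ((intervalIntegral.continuous_parametric_intervalIntegral_of_continuous' hc 0
      t).intervalIntegrable _ _), h.mean, intervalIntegral_swap_of_continuous hc]
  simp only [integral_periodic_sub (h.src_per _), h.integral_src]
  simp

/-- The equation is autonomous, so estimates from time 0 apply from any later time. -/
theorem shift (h : IsReflectedTransport b R) {S : ℝ} (hS : 0 ≤ S) :
    IsReflectedTransport b fun t => R (S + t) where
  b_cont := h.b_cont
  b_nonneg := h.b_nonneg
  b_even := h.b_even
  b_per := h.b_per
  cont := h.cont_comp (by fun_prop) (by fun_prop)
  per t := h.per (S + t)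
  mean := by simpa using h.mean_eq hS
  eqn t ht σ := by
    have := h.eqn_sub hS (by linarith : 0 ≤ S + t) (σ + S)
    have e : σ + S - (S + t) = σ - t := by ring
    rw [e, add_sub_cancel_right] at this
    rw [this, add_zero]
    congr 1
    have h2 := intervalIntegral.integral_comp_add_left (a := 0) (b := t)
      (fun s => src b R s (σ + S - s)) S
    rw [add_zero] at h2
    rw [← h2]
    refine intervalIntegral.integral_congr fun s _ => ?_
    have e : σ + S - (S + s) = σ - s := by ring
    simp only [src, e]

theorem continuous_modularEnergy (h : IsReflectedTransport b R) {p : ℝ} (hp : 1 < p) :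
    Continuous (modularEnergy p R) :=
  intervalIntegral.continuous_parametric_intervalIntegral_of_continuous'
    (f := fun t x => G p (R t x)) ((continuous_G (by linarith)).comp h.cont) _ _

theorem modularEnergy_nonneg {p : ℝ} (hp : 1 < p) (t : ℝ) : 0 ≤ modularEnergy p R t :=
  intervalIntegral.integral_nonneg (by norm_num) fun _ _ => G_nonneg hp _

theorem dissipation_integrand_nonneg (h : IsReflectedTransport b R) {p : ℝ} (hp : 1 < p)
    (t x : ℝ) :
    0 ≤ b x * ((gDeriv p (R t x) - gDeriv p (R t (-x))) * (R t x - R t (-x))) := by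
  refine mul_nonneg (h.b_nonneg x) ?_
  rcases le_total (R t x) (R t (-x)) with hx | hx
  · exact mul_nonneg_of_nonpos_of_nonpos (sub_nonpos.2 (monotone_gDeriv hp hx)) (sub_nonpos.2 hx)
  · exact mul_nonneg (sub_nonneg.2 (monotone_gDeriv hp hx)) (sub_nonneg.2 hx)

theorem dissipation_nonneg (h : IsReflectedTransport b R) {p : ℝ} (hp : 1 < p) (t : ℝ) :
    0 ≤ dissipation p b R t :=
  mul_nonneg (by norm_num) (intervalIntegral.integral_nonneg (by norm_num)
    fun x _ => h.dissipation_integrand_nonneg hp t x)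

theorem dissipation_integrand_continuous (h : IsReflectedTransport b R) {p : ℝ} (hp : 1 < p) :
    Continuous (Function.uncurry fun t x : ℝ =>
      b x * ((gDeriv p (R t x) - gDeriv p (R t (-x))) * (R t x - R t (-x)))) := by
  have hg := continuous_gDeriv hp
  have h1 : Continuous fun q : ℝ × ℝ => R q.1 q.2 := h.cont
  have h2 : Continuous fun q : ℝ × ℝ => R q.1 (-q.2) := h.cont_comp (by fun_prop) (by fun_prop)
  have h3 : Continuous fun q : ℝ × ℝ => b q.2 := h.b_cont.comp continuous_snd
  exact h3.mul (((hg.comp h1).sub (hg.comp h2)).mul (h1.sub h2))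

/-- The energy identity. -/
theorem modularEnergy_eq (h : IsReflectedTransport b R) {p : ℝ} (hp : 1 < p) {t : ℝ}
    (ht : 0 ≤ t) :
    modularEnergy p R t = modularEnergy p R 0 - ∫ s in (0 : ℝ)..t, dissipation p b R s := by
  have hg := continuous_gDeriv hp
  have hG := continuous_G (p := p) (by linarith)
  have hR0 : Continuous fun σ => R 0 σ := h.cont_comp continuous_const continuous_id
  have hGR : Continuous fun σ => G p (R 0 σ) := hG.comp hR0
  have hR : ∀ s, Continuous fun σ => R s σ := fun s => h.cont_comp continuous_const continuous_id
  have hc : Continuous (Function.uncurry fun σ s => gDeriv p (R s (σ - s)) * src b R s (σ - s)) :=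
    (hg.comp (h.cont_comp continuous_snd (by fun_prop))).mul
      (h.src_cont continuous_snd (by fun_prop))
  have hper : ∀ s, Function.Periodic (fun y => G p (R s y)) 2 := fun s y => by
    simp only [h.per s y]
  have key : ∀ σ, G p (R t (σ - t)) = G p (R 0 σ)
      + ∫ s in (0 : ℝ)..t, gDeriv p (R s (σ - s)) * src b R s (σ - s) := by
    intro σ
    have hs : Continuous fun s => src b R s (σ - s) := h.src_cont continuous_id (by fun_prop)
    -- The mild equation holds only for nonnegative times, so its right-hand side, which is
    -- differentiable at every `s`, is differentiated instead of `R`.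
    have hd : ∀ s, HasDerivAt (fun s => R 0 σ + ∫ r in (0 : ℝ)..s, src b R r (σ - r))
        (src b R s (σ - s)) s := fun s =>
      (intervalIntegral.integral_hasDerivAt_right (hs.intervalIntegrable _ _)
        (hs.stronglyMeasurableAtFilter _ _) hs.continuousAt).const_add _
    have hd2 := fun s => (hasDerivAt_G hp _).comp s (hd s)
    have := intervalIntegral.integral_eq_sub_of_hasDerivAt (a := 0) (b := t)
      (fun s _ => hd2 s) (by
        refine (Continuous.mul (hg.comp ?_) hs).intervalIntegrable _ _
        exact continuous_iff_continuousAt.2 fun s => (hd s).continuousAt)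
    have e : ∫ s in (0 : ℝ)..t, gDeriv p (R s (σ - s)) * src b R s (σ - s)
        = ∫ s in (0 : ℝ)..t, gDeriv p (R 0 σ + ∫ r in (0 : ℝ)..s, src b R r (σ - r))
          * src b R s (σ - s) := by
      refine intervalIntegral.integral_congr fun s hs => ?_
      rw [uIcc_of_le ht] at hs
      simp only [h.eqn s hs.1]
    rw [e, this, h.eqn t ht]
    simp
  unfold modularEnergy
  rw [← integral_periodic_sub (hper t) t]
  simp only [key]
  rw [intervalIntegral.integral_add (hGR.intervalIntegrable _ _)
    ((intervalIntegral.continuous_parametric_intervalIntegral_of_continuous' hc 0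
      t).intervalIntegrable _ _), intervalIntegral_swap_of_continuous hc, sub_eq_add_neg,
      ← intervalIntegral.integral_neg]
  congr 1
  refine intervalIntegral.integral_congr fun s _ => ?_
  have hφ : Function.Periodic (fun y => gDeriv p (R s y) * src b R s y) 2 := fun y => by
    simp only [h.per s y, h.src_per s y]
  have h1 := integral_periodic_sub hφ s
  have h2 := integral_symm_neg (fun y => gDeriv p (R s y) * src b R s y)
  have hi : ∀ u : ℝ → ℝ, Continuous u → IntervalIntegrable u volume (-1) 1 := fun u hu =>
    hu.intervalIntegrable _ _
  have hsc : Continuous fun y => src b R s y := h.src_cont continuous_const continuous_id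
  -- Averaging over `y` and `-y` and using that the source is odd produces the difference of the two
  -- values of `gDeriv`; the factor 1/4 is this 1/2 times the 1/2 in `src`.
  have h3 : ∫ y in (-1 : ℝ)..1, gDeriv p (R s y) * src b R s y
      = (1 / 2) * ∫ y in (-1 : ℝ)..1, (gDeriv p (R s y) * src b R s y
        + gDeriv p (R s (-y)) * src b R s (-y)) := by
    have c1 : Continuous fun y => gDeriv p (R s y) * src b R s y := (hg.comp (hR s)).mul hsc
    have c2 : Continuous fun y => gDeriv p (R s (-y)) * src b R s (-y) := c1.comp continuous_neg
    rw [intervalIntegral.integral_add (hi _ c1) (hi _ c2), h2]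
    ring
  simp only [h1, h3, dissipation, ← intervalIntegral.integral_const_mul,
    ← intervalIntegral.integral_neg]
  refine intervalIntegral.integral_congr fun y _ => ?_
  simp only [src, h.b_even, neg_neg]
  ring

theorem modularEnergy_antitoneOn (h : IsReflectedTransport b R) {p : ℝ} (hp : 1 < p) {S t : ℝ}
    (hS : 0 ≤ S) (hSt : S ≤ t) : modularEnergy p R t ≤ modularEnergy p R S := by
  have := (h.shift hS).modularEnergy_eq hp (sub_nonneg.2 hSt)
  have h2 : 0 ≤ ∫ s in (0 : ℝ)..(t - S), dissipation p b (fun t => R (S + t)) s :=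
    intervalIntegral.integral_nonneg (sub_nonneg.2 hSt)
      fun s _ => (h.shift hS).dissipation_nonneg hp s
  simp only [modularEnergy, add_zero, add_sub_cancel] at this ⊢
  linarith

end IsReflectedTransport

/-! ### Translations of a periodic function and a Poincaré inequality -/

/-- The modular of the difference between a periodic function and its translate by `u`. -/
def oscillation (p : ℝ) (f : ℝ → ℝ) (u : ℝ) : ℝ := ∫ s in (-1 : ℝ)..1, G p (f (s + u) - f s)

section oscillation

variable {p : ℝ} {f : ℝ → ℝ}

theorem oscillation_nonneg (hp : 1 < p) (u : ℝ) : 0 ≤ oscillation p f u :=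
  intervalIntegral.integral_nonneg (by norm_num) fun _ _ => G_nonneg hp _

theorem continuous_oscillation (hp : 1 < p) (hf : Continuous f) :
    Continuous (oscillation p f) := by
  refine intervalIntegral.continuous_parametric_intervalIntegral_of_continuous'
    (f := fun u s => G p (f (s + u) - f s)) ?_ _ _
  exact (continuous_G (by linarith)).comp (by fun_prop)

/-- Translating by `v` turns the left side into the modular of `f(s+u) - f(s+v)`, to which the
quasi-triangle inequality for `G p` applies. -/
theorem oscillation_sub_le (hp : p ∈ Ioo (1 : ℝ) 2) (hf : Continuous f)
    (hper : Function.Periodic f 2) (u v : ℝ) :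
    oscillation p f (u - v) ≤ 2 * (oscillation p f u + oscillation p f v) := by
  have hG := continuous_G (p := p) (by linarith [hp.1])
  have h1 : oscillation p f (u - v) = ∫ s in (-1 : ℝ)..1, G p (f (s + u) - f (s + v)) := by
    have hφ : Function.Periodic (fun s => G p (f (s + (u - v)) - f s)) 2 := fun s => by
      simp only [hper s, add_right_comm s 2, hper (s + (u - v))]
    rw [oscillation, ← integral_periodic_add hφ v]
    refine intervalIntegral.integral_congr fun s _ => ?_
    have e : s + v + (u - v) = s + u := by ring
    simp only [e]
  have hi : ∀ u : ℝ → ℝ, Continuous u → IntervalIntegrable u volume (-1) 1 := fun u hu =>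
    hu.intervalIntegrable _ _
  have c1 : ∀ w, Continuous fun s => G p (f (s + w) - f s) := fun w => hG.comp (by fun_prop)
  rw [h1]
  unfold oscillation
  rw [← intervalIntegral.integral_add (hi _ (c1 u)) (hi _ (c1 v)),
    ← intervalIntegral.integral_const_mul]
  refine intervalIntegral.integral_mono_on (by norm_num) (hi _ (hG.comp (by fun_prop)))
    (hi _ (((c1 u).add (c1 v)).const_smul (2 : ℝ))) fun s _ => ?_
  have := G_sub_le hp (f (s + u) - f s) (f (s + v) - f s)
  rwa [sub_sub_sub_cancel_right] at this

/-- The oscillation is even in the step, and `2u = u - (-u)`. -/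
theorem oscillation_two_mul_le (hp : p ∈ Ioo (1 : ℝ) 2) (hf : Continuous f)
    (hper : Function.Periodic f 2) (u : ℝ) :
    oscillation p f (2 * u) ≤ 4 * oscillation p f u := by
  have h1 : oscillation p f (-u) = oscillation p f u := by
    have hφ : Function.Periodic (fun s => G p (f (s + -u) - f s)) 2 := fun s => by
      simp only [hper s, add_right_comm s 2, hper (s + -u)]
    rw [oscillation, ← integral_periodic_add hφ u]
    refine intervalIntegral.integral_congr fun s _ => ?_
    simp only [add_neg_cancel_right]
    rw [← G_neg, neg_sub]
  have := oscillation_sub_le hp hf hper u (-u)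
  rw [h1] at this
  have e : u - -u = 2 * u := by ring
  rw [e] at this
  linarith

theorem oscillation_two_pow_mul_le (hp : p ∈ Ioo (1 : ℝ) 2) (hf : Continuous f)
    (hper : Function.Periodic f 2) (u : ℝ) (k : ℕ) :
    oscillation p f (2 ^ k * u) ≤ 4 ^ k * oscillation p f u := by
  induction k with
  | zero => simp
  | succ k ih =>
    have := oscillation_two_mul_le hp hf hper (2 ^ k * u)
    have e : (2 : ℝ) ^ (k + 1) * u = 2 * (2 ^ k * u) := by ring
    rw [e, pow_succ]
    linarith

/-- Small translations are controlled by the translations by `2x`, for `x` in an interval. -/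
theorem oscillation_le_of_small (hp : p ∈ Ioo (1 : ℝ) 2) (hf : Continuous f)
    (hper : Function.Periodic f 2) {c l y : ℝ} (hl : 0 < l) (hy : 0 ≤ y) (hyl : y ≤ l / 2) :
    oscillation p f (2 * y) ≤ 8 / l * ∫ x in c..(c + l), oscillation p f (2 * x) := by
  have ho := continuous_oscillation hp.1 hf
  have c1 : Continuous fun x => oscillation p f (2 * x) := ho.comp (by fun_prop)
  have c2 : Continuous fun x => oscillation p f (2 * (x + y)) := ho.comp (by fun_prop)
  have hi : ∀ (a b : ℝ) (u : ℝ → ℝ), Continuous u → IntervalIntegrable u volume a b :=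
    fun a b u hu => hu.intervalIntegrable _ _
  -- The step `2y` is the difference of `2(x+y)` and `2x`. Averaging over the first half of the
  -- interval keeps both `x` and `x + y` inside `[c, c+l]`.
  have h1 : ∫ _x in c..(c + l / 2), oscillation p f (2 * y)
      ≤ ∫ x in c..(c + l / 2), 2 * (oscillation p f (2 * (x + y)) + oscillation p f (2 * x)) := by
    refine intervalIntegral.integral_mono_on (by linarith) (hi _ _ _ continuous_const)
      (hi _ _ _ ((c2.add c1).const_smul (2 : ℝ))) fun x _ => ?_
    have := oscillation_sub_le hp hf hper (2 * (x + y)) (2 * x)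
    have e : 2 * (x + y) - 2 * x = 2 * y := by ring
    rwa [e] at this
  rw [intervalIntegral.integral_const, intervalIntegral.integral_const_mul,
    intervalIntegral.integral_add (hi _ _ _ c2) (hi _ _ _ c1),
    intervalIntegral.integral_comp_add_right (fun x => oscillation p f (2 * x)) y, smul_eq_mul]
    at h1
  have hmono : ∀ a b, c ≤ a → a ≤ b → b ≤ c + l →
      ∫ x in a..b, oscillation p f (2 * x) ≤ ∫ x in c..(c + l), oscillation p f (2 * x) :=
    fun a b ha hab hb => intervalIntegral.integral_mono_interval ha hab hb
      (ae_of_all _ fun x => oscillation_nonneg hp.1 _) (hi _ _ _ c1)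
  have h2 := hmono (c + y) (c + l / 2 + y) (by linarith) (by linarith) (by linarith)
  have h3 := hmono c (c + l / 2) le_rfl (by linarith) (by linarith)
  rw [div_mul_eq_mul_div, le_div_iff₀ hl]
  linarith

/-- A Poincaré inequality for the modular. -/
theorem modular_le_of_oscillation_le (hp : p ∈ Ioo (1 : ℝ) 2) (hf : Continuous f)
    (hper : Function.Periodic f 2) (hmean : ∫ x in (-1 : ℝ)..1, f x = 0) {Q : ℝ}
    (hQ : ∀ u ∈ Icc (-1 : ℝ) 1, oscillation p f u ≤ Q) :
    ∫ s in (-1 : ℝ)..1, G p (f s) ≤ Q := by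
  have hG := continuous_G (p := p) (by linarith [hp.1])
  have hc : Continuous (Function.uncurry fun s u => G p (f (s + u) - f s)) :=
    hG.comp (by fun_prop)
  -- Since `f` has zero mean, `-f(s)` is the average over `u` of `f(s+u) - f(s)`; Jensen applies.
  have h1 : ∀ s, G p (f s) ≤ (1 / 2) * ∫ u in (-1 : ℝ)..1, G p (f (s + u) - f s) := by
    intro s
    have h := G_average_le hp.1 (u := fun u => f (s + u) - f s) (by fun_prop) (-1)
    have e : (-1 : ℝ) + 2 = 1 := by norm_num
    rw [e, intervalIntegral.integral_sub
      ((by fun_prop : Continuous fun u => f (s + u)).intervalIntegrable _ _)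
      (continuous_const.intervalIntegrable _ _)] at h
    have h2 := integral_periodic_add hper s
    simp only [add_comm _ s] at h2
    rw [h2, hmean, intervalIntegral.integral_const, smul_eq_mul, ← G_neg] at h
    have e2 : -(1 / 2 * (0 - (1 - -1) * f s)) = f s := by ring
    rwa [e2] at h
  have h2 : ∫ s in (-1 : ℝ)..1, G p (f s)
      ≤ ∫ s in (-1 : ℝ)..1, (1 / 2) * ∫ u in (-1 : ℝ)..1, G p (f (s + u) - f s) := by
    refine intervalIntegral.integral_mono_on (by norm_num)
      ((hG.comp hf).intervalIntegrable _ _) ?_ fun s _ => h1 s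
    exact ((intervalIntegral.continuous_parametric_intervalIntegral_of_continuous' hc _
      _).const_smul (1 / 2 : ℝ)).intervalIntegrable _ _
  rw [intervalIntegral.integral_const_mul, intervalIntegral_swap_of_continuous hc] at h2
  have h3 : ∫ u in (-1 : ℝ)..1, oscillation p f u ≤ ∫ _u in (-1 : ℝ)..1, Q :=
    intervalIntegral.integral_mono_on (by norm_num)
      ((continuous_oscillation hp.1 hf).intervalIntegrable _ _)
      (continuous_const.intervalIntegrable _ _) hQ
  rw [intervalIntegral.integral_const, smul_eq_mul] at h3
  unfold oscillation at h3
  linarith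

end oscillation

/-! ### Observability over one period of time -/

/-- The modular of the damped part of the solution on the time interval `[0,2]`. -/
def dampedModular (p : ℝ) (b : ℝ → ℝ) (R : ℝ → ℝ → ℝ) : ℝ :=
  ∫ t in (0 : ℝ)..2, ∫ x in (-1 : ℝ)..1, b x * G p (R t x - R t (-x))

/-- A bound for the variation of the solution along a characteristic for times in `[0,2]`. -/
def deviation (b : ℝ → ℝ) (R : ℝ → ℝ → ℝ) (σ : ℝ) : ℝ :=
  (1 / 2) * ∫ s in (0 : ℝ)..2, b (σ - s) * |R s (σ - s) - R s (-(σ - s))|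

namespace IsReflectedTransport

variable {b : ℝ → ℝ} {R : ℝ → ℝ → ℝ}

theorem jump_cont (h : IsReflectedTransport b R) {X : Type*} [TopologicalSpace X] {u v : X → ℝ}
    (hu : Continuous u) (hv : Continuous v) :
    Continuous fun x => R (u x) (v x) - R (u x) (-v x) :=
  (h.cont_comp hu hv).sub (h.cont_comp hu hv.neg)

theorem jump_per (h : IsReflectedTransport b R) (s : ℝ) :
    Function.Periodic (fun y => R s y - R s (-y)) 2 := by
  intro y
  have e : -(y + 2) = -y - 2 := by ring
  simp only [h.per s y, e, (h.per s).sub_eq]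

theorem deviation_integrand_cont (h : IsReflectedTransport b R) :
    Continuous (Function.uncurry fun σ s => b (σ - s) * |R s (σ - s) - R s (-(σ - s))|) :=
  (h.b_cont.comp (by fun_prop)).mul (h.jump_cont continuous_snd (by fun_prop)).abs

theorem continuous_deviation (h : IsReflectedTransport b R) : Continuous (deviation b R) :=
  (intervalIntegral.continuous_parametric_intervalIntegral_of_continuous'
    h.deviation_integrand_cont 0 2).const_smul (1 / 2 : ℝ)

theorem deviation_per (h : IsReflectedTransport b R) : Function.Periodic (deviation b R) 2 := by
  intro σ
  unfold deviation
  congr 1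
  refine intervalIntegral.integral_congr fun s _ => ?_
  have e : σ + 2 - s = σ - s + 2 := by ring
  have := h.jump_per s (σ - s)
  simp only at this
  simp only [e, this, h.b_per (σ - s)]

/-- One bound serves all times in `[0,2]` because the integrand of `deviation` is nonnegative. -/
theorem abs_sub_le_deviation (h : IsReflectedTransport b R) {t : ℝ} (ht : t ∈ Icc (0 : ℝ) 2)
    (σ : ℝ) : |R t (σ - t) - R 0 σ| ≤ deviation b R σ := by
  have hc : Continuous fun s => b (σ - s) * |R s (σ - s) - R s (-(σ - s))| :=
    h.deviation_integrand_cont.comp (by fun_prop : Continuous fun s : ℝ => (σ, s))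
  rw [h.eqn t ht.1, add_sub_cancel_left]
  calc |∫ s in (0 : ℝ)..t, src b R s (σ - s)|
      ≤ ∫ s in (0 : ℝ)..t, |src b R s (σ - s)| :=
        intervalIntegral.abs_integral_le_integral_abs ht.1
    _ = ∫ s in (0 : ℝ)..t, (1 / 2) * (b (σ - s) * |R s (σ - s) - R s (-(σ - s))|) := by
        refine intervalIntegral.integral_congr fun s _ => ?_
        simp only [src, abs_neg, abs_div, abs_mul, abs_of_nonneg (h.b_nonneg _), abs_two]
        ring
    _ ≤ ∫ s in (0 : ℝ)..2, (1 / 2) * (b (σ - s) * |R s (σ - s) - R s (-(σ - s))|) :=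
        intervalIntegral.integral_mono_interval le_rfl ht.1 ht.2
          (ae_of_all _ fun s => mul_nonneg (by norm_num)
            (mul_nonneg (h.b_nonneg _) (abs_nonneg _)))
          ((hc.const_smul (1 / 2 : ℝ)).intervalIntegrable _ _)
    _ = deviation b R σ := intervalIntegral.integral_const_mul _ _

theorem damped_integrand_cont (h : IsReflectedTransport b R) {p : ℝ} (hp : 1 < p) {X : Type*}
    [TopologicalSpace X] {u v : X → ℝ} (hu : Continuous u) (hv : Continuous v) :
    Continuous fun x => b (v x) * G p (R (u x) (v x) - R (u x) (-v x)) :=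
  (h.b_cont.comp hv).mul ((continuous_G (by linarith)).comp (h.jump_cont hu hv))

theorem damped_inner_cont (h : IsReflectedTransport b R) {p : ℝ} (hp : 1 < p) :
    Continuous fun t => ∫ x in (-1 : ℝ)..1, b x * G p (R t x - R t (-x)) :=
  intervalIntegral.continuous_parametric_intervalIntegral_of_continuous'
    (f := fun t x => b x * G p (R t x - R t (-x)))
    (h.damped_integrand_cont hp continuous_fst continuous_snd) _ _

/-- Jensen on `[0,2]`, then `b|q| = (b/A)(A|q|)`: convexity extracts `b/A ≤ 1` and the quadratic
growth costs `A²`, which is why `A ≥ 1` is assumed. One factor `b` survives, as `dampedModular`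
requires. -/
theorem G_deviation_le (h : IsReflectedTransport b R) {p : ℝ} (hp : p ∈ Ioo (1 : ℝ) 2) {A : ℝ}
    (hA : 1 ≤ A) (hb : ∀ y, b y ≤ A) (σ : ℝ) :
    G p (deviation b R σ)
      ≤ A / 2 * ∫ s in (0 : ℝ)..2, b (σ - s) * G p (R s (σ - s) - R s (-(σ - s))) := by
  have hA0 : 0 < A := by linarith
  have hc : Continuous fun s => b (σ - s) * |R s (σ - s) - R s (-(σ - s))| :=
    h.deviation_integrand_cont.comp (by fun_prop : Continuous fun s : ℝ => (σ, s))
  have hd : Continuous fun s => b (σ - s) * G p (R s (σ - s) - R s (-(σ - s))) :=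
    h.damped_integrand_cont hp.1 continuous_id (by fun_prop)
  have h1 := G_average_le hp.1 hc 0
  rw [zero_add] at h1
  refine h1.trans ?_
  have h2 : ∫ s in (0 : ℝ)..2, G p (b (σ - s) * |R s (σ - s) - R s (-(σ - s))|)
      ≤ ∫ s in (0 : ℝ)..2, A * (b (σ - s) * G p (R s (σ - s) - R s (-(σ - s)))) := by
    refine intervalIntegral.integral_mono_on (by norm_num)
      (((continuous_G (by linarith [hp.1])).comp hc).intervalIntegrable _ _)
      ((hd.const_smul A).intervalIntegrable _ _) fun s _ => ?_
    set q := R s (σ - s) - R s (-(σ - s))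
    have e : b (σ - s) * |q| = b (σ - s) / A * (A * |q|) := by field_simp
    rw [e]
    refine (G_mul_le hp.1 (div_nonneg (h.b_nonneg _) hA0.le)
      ((div_le_one hA0).2 (hb _)) _).trans ?_
    have h3 := G_mul_le_sq hp hA |q|
    rw [G_abs] at h3
    calc b (σ - s) / A * G p (A * |q|) ≤ b (σ - s) / A * (A ^ 2 * G p q) :=
          mul_le_mul_of_nonneg_left h3 (div_nonneg (h.b_nonneg _) hA0.le)
      _ = A * (b (σ - s) * G p q) := by field_simp
  rw [intervalIntegral.integral_const_mul] at h2
  linarith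

theorem integral_G_deviation_le (h : IsReflectedTransport b R) {p : ℝ} (hp : p ∈ Ioo (1 : ℝ) 2)
    {A : ℝ} (hA : 1 ≤ A) (hb : ∀ y, b y ≤ A) :
    ∫ σ in (-1 : ℝ)..1, G p (deviation b R σ) ≤ A / 2 * dampedModular p b R := by
  have hc : Continuous (Function.uncurry fun σ s =>
      b (σ - s) * G p (R s (σ - s) - R s (-(σ - s)))) :=
    h.damped_integrand_cont hp.1 continuous_snd (by fun_prop)
  have hG := continuous_G (p := p) (by linarith [hp.1])
  have h1 : ∫ σ in (-1 : ℝ)..1, G p (deviation b R σ) ≤ ∫ σ in (-1 : ℝ)..1,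
      A / 2 * ∫ s in (0 : ℝ)..2, b (σ - s) * G p (R s (σ - s) - R s (-(σ - s))) :=
    intervalIntegral.integral_mono_on (by norm_num)
      ((hG.comp h.continuous_deviation).intervalIntegrable _ _)
      (((intervalIntegral.continuous_parametric_intervalIntegral_of_continuous' hc 0
        2).const_smul (A / 2)).intervalIntegrable _ _)
      fun σ _ => h.G_deviation_le hp hA hb σ
  refine h1.trans_eq ?_
  rw [intervalIntegral.integral_const_mul, intervalIntegral_swap_of_continuous hc, dampedModular]
  congr 1
  refine intervalIntegral.integral_congr fun s _ => ?_
  have hφ : Function.Periodic (fun y => b y * G p (R s y - R s (-y))) 2 := fun y => by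
    have := h.jump_per s y
    simp only at this
    simp only [this, h.b_per y]
  exact integral_periodic_sub hφ s

/-- At time `t` the characteristics issued from `t + x` and `t - x` sit at `x` and `-x`. The initial
difference is therefore two deviations plus the jump `R t x - R t (-x)`, and the jump is seen by the
damping when `x` lies in `[c, c+l]`. -/
theorem integral_oscillation_le (h : IsReflectedTransport b R) {p : ℝ} (hp : p ∈ Ioo (1 : ℝ) 2)
    {A a₀ c l : ℝ} (hA : 1 ≤ A) (hb : ∀ y, b y ≤ A) (ha₀ : 0 < a₀) (hl : 0 < l) (hc : 0 ≤ c)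
    (hcl : c + l ≤ 1) (hlow : ∀ x ∈ Icc c (c + l), a₀ ≤ b x) :
    ∫ x in c..(c + l), oscillation p (R 0) (2 * x)
      ≤ 4 * (l * A + 1 / a₀) * dampedModular p b R := by
  have hG := continuous_G (p := p) (by linarith [hp.1])
  have hG0 := G_nonneg hp.1
  have hf : Continuous (R 0) := h.cont_comp continuous_const continuous_id
  have hdev := h.continuous_deviation
  have hcdev : Continuous fun σ => G p (deviation b R σ) := hG.comp hdev
  have hpdev : Function.Periodic (fun σ => G p (deviation b R σ)) 2 := fun σ => by
    simp only [h.deviation_per σ]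
  have hq : Continuous (Function.uncurry fun x t => G p (R t x - R t (-x))) :=
    hG.comp (h.jump_cont continuous_snd continuous_fst)
  set D := ∫ σ in (-1 : ℝ)..1, G p (deviation b R σ) with hD
  have hDle := h.integral_G_deviation_le hp hA hb
  have hpt : ∀ x, oscillation p (R 0) (2 * x)
      ≤ 4 * (2 * D + ∫ t in (0 : ℝ)..2, G p (R t x - R t (-x))) := by
    intro x
    -- A time interval of length 2 covers exactly one spatial period.
    have h1 : oscillation p (R 0) (2 * x) = ∫ t in (0 : ℝ)..2, G p (R 0 (t + x) - R 0 (t - x)) := by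
      have hφ : Function.Periodic (fun t => G p (R 0 (t + x) - R 0 (t - x))) 2 := fun t => by
        have e : t + 2 - x = t - x + 2 := by ring
        simp only [add_right_comm t 2, h.per 0 (t + x), e, h.per 0 (t - x)]
      rw [integral_zero_two_eq hφ, ← integral_periodic_add hφ x]
      refine intervalIntegral.integral_congr fun s _ => ?_
      have e : s + x + x = s + 2 * x := by ring
      simp only [e, add_sub_cancel_right]
    have hqx : Continuous fun t => G p (R t x - R t (-x)) :=
      hG.comp (h.jump_cont continuous_id continuous_const)
    have cp : Continuous fun t => G p (deviation b R (t + x)) := hcdev.comp (by fun_prop)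
    have cm : Continuous fun t => G p (deviation b R (t - x)) := hcdev.comp (by fun_prop)
    have cpq : Continuous fun t => G p (deviation b R (t + x)) + G p (R t x - R t (-x)) :=
      cp.add hqx
    have h2 : ∫ t in (0 : ℝ)..2, G p (R 0 (t + x) - R 0 (t - x))
        ≤ ∫ t in (0 : ℝ)..2, 4 * (G p (deviation b R (t + x)) + G p (R t x - R t (-x))
          + G p (deviation b R (t - x))) := by
      refine intervalIntegral.integral_mono_on (by norm_num)
        ((hG.comp (by fun_prop)).intervalIntegrable _ _)
        ((((cp.add hqx).add cm).const_smul (4 : ℝ)).intervalIntegrable _ _) fun t ht => ?_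
      have h3 := G_add_three_le hp (R 0 (t + x) - R t x) (R t x - R t (-x))
        (R t (-x) - R 0 (t - x))
      have e : R 0 (t + x) - R t x + (R t x - R t (-x)) + (R t (-x) - R 0 (t - x))
          = R 0 (t + x) - R 0 (t - x) := by ring
      rw [e] at h3
      have d1 := h.abs_sub_le_deviation ht (t + x)
      have d2 := h.abs_sub_le_deviation ht (t - x)
      rw [add_sub_cancel_left, abs_sub_comm] at d1
      rw [sub_sub_cancel_left] at d2
      have g1 := G_le_G hp.1 (d1.trans (le_abs_self _))
      have g2 := G_le_G hp.1 (d2.trans (le_abs_self _))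
      linarith
    rw [h1]
    refine h2.trans_eq ?_
    rw [intervalIntegral.integral_const_mul, intervalIntegral.integral_add
      (cpq.intervalIntegrable _ _) (cm.intervalIntegrable _ _),
      intervalIntegral.integral_add (cp.intervalIntegrable _ _) (hqx.intervalIntegrable _ _)]
    have p1 : Function.Periodic (fun t => G p (deviation b R (t + x))) 2 := fun t => by
      simp only [add_right_comm t 2, h.deviation_per (t + x)]
    have p2 : Function.Periodic (fun t => G p (deviation b R (t - x))) 2 := fun t => by
      have e : t + 2 - x = t - x + 2 := by ring
      simp only [e, h.deviation_per (t - x)]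
    have i1 := integral_periodic_add hpdev x
    have i2 := integral_periodic_sub hpdev x
    rw [integral_zero_two_eq p1, integral_zero_two_eq p2, i1, i2]
    ring
  have hcc : c ≤ c + l := by linarith
  have hqi := intervalIntegral.continuous_parametric_intervalIntegral_of_continuous' hq 0 2
    (μ := volume)
  have h4 : ∫ x in c..(c + l), oscillation p (R 0) (2 * x)
      ≤ ∫ x in c..(c + l), 4 * (2 * D + ∫ t in (0 : ℝ)..2, G p (R t x - R t (-x))) :=
    intervalIntegral.integral_mono_on hcc
      (((continuous_oscillation hp.1 hf).comp (by fun_prop)).intervalIntegrable _ _)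
      (((continuous_const.add hqi).const_smul (4 : ℝ)).intervalIntegrable _ _) fun x _ => hpt x
  rw [intervalIntegral.integral_const_mul, intervalIntegral.integral_add
    (continuous_const.intervalIntegrable _ _) (hqi.intervalIntegrable _ _),
    intervalIntegral.integral_const, smul_eq_mul, add_sub_cancel_left,
    intervalIntegral_swap_of_continuous hq] at h4
  have h5 : ∫ t in (0 : ℝ)..2, ∫ x in c..(c + l), G p (R t x - R t (-x))
      ≤ ∫ t in (0 : ℝ)..2, 1 / a₀ * ∫ x in (-1 : ℝ)..1, b x * G p (R t x - R t (-x)) := by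
    have hq' : Continuous (Function.uncurry fun t x => G p (R t x - R t (-x))) :=
      hG.comp (h.jump_cont continuous_fst continuous_snd)
    refine intervalIntegral.integral_mono_on (by norm_num)
      ((intervalIntegral.continuous_parametric_intervalIntegral_of_continuous' hq' _
        _).intervalIntegrable _ _)
      (((h.damped_inner_cont hp.1).const_smul (1 / a₀)).intervalIntegrable _ _) fun t _ => ?_
    have k1 : Continuous fun x => G p (R t x - R t (-x)) :=
      hG.comp (h.jump_cont continuous_const continuous_id)
    have k2 : Continuous fun x => b x * G p (R t x - R t (-x)) := h.b_cont.mul k1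
    have k3 : ∫ x in c..(c + l), a₀ * G p (R t x - R t (-x))
        ≤ ∫ x in c..(c + l), b x * G p (R t x - R t (-x)) :=
      intervalIntegral.integral_mono_on hcc ((k1.const_smul a₀).intervalIntegrable _ _)
        (k2.intervalIntegrable _ _) fun x hx => mul_le_mul_of_nonneg_right (hlow x hx) (hG0 _)
    have k4 : ∫ x in c..(c + l), b x * G p (R t x - R t (-x))
        ≤ ∫ x in (-1 : ℝ)..1, b x * G p (R t x - R t (-x)) :=
      intervalIntegral.integral_mono_interval (by linarith) hcc hcl
        (ae_of_all _ fun x => mul_nonneg (h.b_nonneg x) (hG0 _)) (k2.intervalIntegrable _ _)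
    rw [intervalIntegral.integral_const_mul] at k3
    rw [one_div_mul_eq_div, le_div_iff₀ ha₀]
    linarith
  rw [intervalIntegral.integral_const_mul] at h5
  change _ ≤ 1 / a₀ * dampedModular p b R at h5
  have h6 : l * (2 * D) ≤ l * (A * dampedModular p b R) :=
    mul_le_mul_of_nonneg_left (by linarith) hl.le
  linarith

end IsReflectedTransport

/-- The observability inequality for the modular energy. -/
theorem exists_observability_const {A a₀ l : ℝ} (hA : 1 ≤ A) (ha₀ : 0 < a₀) (hl : 0 < l) :
    ∃ K : ℝ, 0 < K ∧ ∀ (b : ℝ → ℝ) (R : ℝ → ℝ → ℝ), IsReflectedTransport b R →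
      (∀ y, b y ≤ A) → ∀ c, 0 ≤ c → c + l ≤ 1 → (∀ x ∈ Icc c (c + l), a₀ ≤ b x) →
      ∀ p ∈ Ioo (1 : ℝ) 2, modularEnergy p R 0 ≤ K * dampedModular p b R := by
  -- Halving a step `u ≤ 2` this often leaves `2y` with `y ≤ l/2`; doubling back costs `4^k`, with
  -- `k` depending on `l` only.
  obtain ⟨k, hk⟩ := pow_unbounded_of_one_lt (2 / l) (by norm_num : (1 : ℝ) < 2)
  refine ⟨4 ^ k * (8 / l * (4 * (l * A + 1 / a₀))), by positivity, ?_⟩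
  intro b R h hb c hc hcl hlow p hp
  have hf : Continuous (R 0) := h.cont_comp continuous_const continuous_id
  refine modular_le_of_oscillation_le hp hf (h.per 0) h.mean fun u hu => ?_
  have hsmall : ∀ u ∈ Icc (0 : ℝ) 2, oscillation p (R 0) u
      ≤ 4 ^ k * (8 / l * (4 * (l * A + 1 / a₀))) * dampedModular p b R := by
    intro u hu
    have hk0 : (0 : ℝ) < 2 ^ k := by positivity
    have hy : u / (2 * 2 ^ k) ≤ l / 2 := by
      rw [div_lt_iff₀ hl] at hk
      rw [div_le_div_iff₀ (by positivity) (by norm_num)]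
      nlinarith [hu.2]
    have h1 := oscillation_le_of_small hp hf (h.per 0) (c := c) hl
      (div_nonneg hu.1 (by positivity)) hy
    have h2 := oscillation_two_pow_mul_le hp hf (h.per 0) (2 * (u / (2 * 2 ^ k))) k
    have e : 2 ^ k * (2 * (u / (2 * 2 ^ k))) = u := by field_simp
    rw [e] at h2
    have h3 := h.integral_oscillation_le hp hA hb ha₀ hl hc hcl hlow
    calc oscillation p (R 0) u ≤ 4 ^ k * oscillation p (R 0) (2 * (u / (2 * 2 ^ k))) := h2
      _ ≤ 4 ^ k * (8 / l * ∫ x in c..(c + l), oscillation p (R 0) (2 * x)) := by gcongr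
      _ ≤ 4 ^ k * (8 / l * (4 * (l * A + 1 / a₀) * dampedModular p b R)) := by gcongr
      _ = _ := by ring
  rcases le_total 0 u with h0 | h0
  · exact hsmall u ⟨h0, by linarith [hu.2]⟩
  · have : oscillation p (R 0) u = oscillation p (R 0) (u + 2) := by
      unfold oscillation
      simp only [← add_assoc, h.per 0 _]
    rw [this]
    exact hsmall _ ⟨by linarith [hu.1], by linarith⟩

/-! ### Absorption and the integral estimate -/

namespace IsReflectedTransport

variable {b : ℝ → ℝ} {R : ℝ → ℝ → ℝ}

theorem continuous_dissipation (h : IsReflectedTransport b R) {p : ℝ} (hp : 1 < p) :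
    Continuous (dissipation p b R) :=
  (intervalIntegral.continuous_parametric_intervalIntegral_of_continuous'
    (h.dissipation_integrand_continuous hp) _ _).const_smul (1 / 4 : ℝ)

/-- The pointwise bound `G_sub_le_dissipation` is integrated against `b`: the first term sums to the
energy loss by the energy identity, the second is bounded by `b ≤ A` and the monotonicity of the
energy. -/
theorem dampedModular_le (h : IsReflectedTransport b R) {p : ℝ} (hp : p ∈ Ioo (1 : ℝ) 2)
    {A ε : ℝ} (hb : ∀ y, b y ≤ A) (hε : 0 < ε) (hε1 : ε ≤ 1) :
    dampedModular p b R ≤ 4 / ((p - 1) * ε) * (modularEnergy p R 0 - modularEnergy p R 2)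
      + 4 * ε * A * modularEnergy p R 0 := by
  have hG := continuous_G (p := p) (by linarith [hp.1])
  have hp1 : 0 < p - 1 := by linarith [hp.1]
  have hA0 : 0 ≤ A := (h.b_nonneg 0).trans (hb 0)
  have hdis := h.dissipation_integrand_continuous hp.1
  have hinner : ∀ t, 0 ≤ t → ∫ x in (-1 : ℝ)..1, b x * G p (R t x - R t (-x))
      ≤ 4 / ((p - 1) * ε) * dissipation p b R t + 2 * ε * A * modularEnergy p R 0 := by
    intro t ht
    have c0 : Continuous fun x => R t x := h.cont_comp continuous_const continuous_id
    have c1 : Continuous fun x => G p (R t x) := hG.comp c0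
    have c2 : Continuous fun x => G p (R t (-x)) := c1.comp continuous_neg
    have c3 : Continuous fun x =>
        b x * ((gDeriv p (R t x) - gDeriv p (R t (-x))) * (R t x - R t (-x))) :=
      hdis.comp (by fun_prop : Continuous fun x : ℝ => (t, x))
    have c4 : Continuous fun x => b x * G p (R t x - R t (-x)) :=
      h.damped_integrand_cont hp.1 continuous_const continuous_id
    have c5 : Continuous fun x => 1 / ((p - 1) * ε) *
        (b x * ((gDeriv p (R t x) - gDeriv p (R t (-x))) * (R t x - R t (-x)))) :=
      c3.const_smul (1 / ((p - 1) * ε))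
    have c6 : Continuous fun x => G p (R t x) + G p (R t (-x)) := c1.add c2
    have c7 : Continuous fun x => ε * A * (G p (R t x) + G p (R t (-x))) :=
      c6.const_smul (ε * A)
    have hm : ∫ x in (-1 : ℝ)..1, b x * G p (R t x - R t (-x))
        ≤ ∫ x in (-1 : ℝ)..1, (1 / ((p - 1) * ε) *
          (b x * ((gDeriv p (R t x) - gDeriv p (R t (-x))) * (R t x - R t (-x))))
          + ε * A * (G p (R t x) + G p (R t (-x)))) := by
      refine intervalIntegral.integral_mono_on (by norm_num) (c4.intervalIntegrable _ _)
        ((c5.add c7).intervalIntegrable _ _) fun x _ => ?_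
      have k := mul_le_mul_of_nonneg_left (G_sub_le_dissipation hp hε hε1 (R t x) (R t (-x)))
        (h.b_nonneg x)
      have hs : 0 ≤ G p (R t x) + G p (R t (-x)) :=
        add_nonneg (G_nonneg hp.1 _) (G_nonneg hp.1 _)
      have k2 : b x * (ε * (G p (R t x) + G p (R t (-x))))
          ≤ A * (ε * (G p (R t x) + G p (R t (-x)))) := by
        have := hb x
        gcongr
      linarith
    rw [intervalIntegral.integral_add (c5.intervalIntegrable _ _) (c7.intervalIntegrable _ _),
      intervalIntegral.integral_const_mul, intervalIntegral.integral_const_mul,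
      intervalIntegral.integral_add (c1.intervalIntegrable _ _) (c2.intervalIntegrable _ _),
      integral_symm_neg fun x => G p (R t x)] at hm
    have hE := h.modularEnergy_antitoneOn hp.1 le_rfl ht
    have k3 : ε * A * modularEnergy p R t ≤ ε * A * modularEnergy p R 0 := by gcongr
    have k4 : 4 / ((p - 1) * ε) * dissipation p b R t = 1 / ((p - 1) * ε) *
        ∫ x in (-1 : ℝ)..1,
          (b x * ((gDeriv p (R t x) - gDeriv p (R t (-x))) * (R t x - R t (-x)))) := by
      unfold dissipation; ring
    unfold modularEnergy at k3 ⊢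
    linarith
  have hcd := h.continuous_dissipation hp.1
  have c8 : Continuous fun t => 4 / ((p - 1) * ε) * dissipation p b R t :=
    hcd.const_smul (4 / ((p - 1) * ε))
  have hm : dampedModular p b R ≤ ∫ t in (0 : ℝ)..2,
      (4 / ((p - 1) * ε) * dissipation p b R t + 2 * ε * A * modularEnergy p R 0) :=
    intervalIntegral.integral_mono_on (by norm_num)
      ((h.damped_inner_cont hp.1).intervalIntegrable _ _)
      ((c8.add continuous_const).intervalIntegrable _ _) fun t ht => hinner t ht.1
  rw [intervalIntegral.integral_add (c8.intervalIntegrable _ _)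
    (continuous_const.intervalIntegrable _ _), intervalIntegral.integral_const_mul,
    intervalIntegral.integral_const, smul_eq_mul] at hm
  have hE := h.modularEnergy_eq hp.1 (t := 2) (by norm_num)
  have hD : ∫ s in (0 : ℝ)..2, dissipation p b R s
      = modularEnergy p R 0 - modularEnergy p R 2 := by linarith
  rw [hD] at hm
  linarith

end IsReflectedTransport

/-- The integral estimate for the modular energy of the reflected transport equation. -/
theorem exists_integral_modularEnergy_const {A a₀ l : ℝ} (hA : 1 ≤ A) (ha₀ : 0 < a₀)
    (hl : 0 < l) :
    ∃ C : ℝ, 0 < C ∧ ∀ (b : ℝ → ℝ) (R : ℝ → ℝ → ℝ), IsReflectedTransport b R →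
      (∀ y, b y ≤ A) → ∀ c, 0 ≤ c → c + l ≤ 1 → (∀ x ∈ Icc c (c + l), a₀ ≤ b x) →
      ∀ p ∈ Ioo (1 : ℝ) 2, ∀ S T : ℝ, 0 ≤ S → S ≤ T →
        ∫ t in S..T, modularEnergy p R t ≤ C * (1 / (p - 1)) * modularEnergy p R S := by
  obtain ⟨K, hK, hobs⟩ := exists_observability_const hA ha₀ hl
  have hA0 : 0 < A := by linarith
  refine ⟨16 * K * (8 * A * K + 1), by positivity, ?_⟩
  intro b R h hb c hc hcl hlow p hp S T hS hST
  have hp1 : 0 < p - 1 := by linarith [hp.1]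
  have hstep : ∀ (R : ℝ → ℝ → ℝ), IsReflectedTransport b R → modularEnergy p R 0
      ≤ 8 * K * (8 * A * K + 1) * (1 / (p - 1)) * (modularEnergy p R 0 - modularEnergy p R 2) := by
    intro R h
    have h1 := hobs b R h hb c hc hcl hlow p hp
    -- With this `ε` the remainder `4 K ε A` is at most 1/2, so it is absorbed on the left.
    have hε : 0 < 1 / (8 * A * K + 1) := by positivity
    have hAK : 0 < A * K := by positivity
    have h2 := h.dampedModular_le hp hb hε
      ((div_le_one (by positivity)).2 (by linarith))
    have h3 := mul_le_mul_of_nonneg_left h2 hK.le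
    have hE : 0 ≤ modularEnergy p R 0 := IsReflectedTransport.modularEnergy_nonneg hp.1 0
    have h4 : K * (4 * (1 / (8 * A * K + 1)) * A * modularEnergy p R 0)
        ≤ 1 / 2 * modularEnergy p R 0 := by
      have e : K * (4 * (1 / (8 * A * K + 1)) * A * modularEnergy p R 0)
          = (4 * A * K) / (8 * A * K + 1) * modularEnergy p R 0 := by ring
      rw [e]
      refine mul_le_mul_of_nonneg_right ?_ hE
      rw [div_le_div_iff₀ (by positivity) (by norm_num)]
      linarith
    have e : 8 * K * (8 * A * K + 1) * (1 / (p - 1))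
        * (modularEnergy p R 0 - modularEnergy p R 2)
        = 2 * (K * (4 / ((p - 1) * (1 / (8 * A * K + 1)))
          * (modularEnergy p R 0 - modularEnergy p R 2))) := by
      field_simp
      ring
    rw [e]
    linarith
  set κ := 8 * K * (8 * A * K + 1) * (1 / (p - 1)) with hκ
  have hκ0 : 0 ≤ κ := by positivity
  have hc := h.continuous_modularEnergy hp.1
  have hc2 : Continuous fun t => modularEnergy p R (t + 2) := hc.comp (by fun_prop)
  have hi : ∀ a b : ℝ, IntervalIntegrable (modularEnergy p R) volume a b := fun a b =>
    hc.intervalIntegrable a b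
  have h1 : ∫ t in S..T, modularEnergy p R t
      ≤ ∫ t in S..T, κ * (modularEnergy p R t - modularEnergy p R (t + 2)) := by
    refine intervalIntegral.integral_mono_on hST (hi _ _)
      (((hc.sub hc2).const_smul κ).intervalIntegrable _ _) fun t ht => ?_
    have := hstep _ (h.shift (hS.trans ht.1))
    simpa only [modularEnergy, add_zero] using this
  rw [intervalIntegral.integral_const_mul, intervalIntegral.integral_sub (hi _ _)
    (hc2.intervalIntegrable _ _), intervalIntegral.integral_comp_add_right] at h1
  -- Telescoping: the difference of the integrals over `[S,T]` and `[S+2,T+2]` is at most the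
  -- integral over `[S,S+2]`.
  have h2 := intervalIntegral.integral_add_adjacent_intervals (hi S (S + 2)) (hi (S + 2) (T + 2))
  have h3 := intervalIntegral.integral_add_adjacent_intervals (hi S T) (hi T (T + 2))
  have h4 : ∫ t in S..(S + 2), modularEnergy p R t ≤ ∫ _t in S..(S + 2), modularEnergy p R S :=
    intervalIntegral.integral_mono_on (by linarith) (hi _ _)
      (continuous_const.intervalIntegrable _ _)
      fun t ht => h.modularEnergy_antitoneOn hp.1 hS ht.1
  rw [intervalIntegral.integral_const, smul_eq_mul, add_sub_cancel_left] at h4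
  have h5 : 0 ≤ ∫ t in T..(T + 2), modularEnergy p R t :=
    intervalIntegral.integral_nonneg (by linarith)
      fun t _ => IsReflectedTransport.modularEnergy_nonneg hp.1 t
  calc ∫ t in S..T, modularEnergy p R t
      ≤ κ * ((∫ t in S..T, modularEnergy p R t) - ∫ t in (S + 2)..(T + 2), modularEnergy p R t) := h1
    _ ≤ κ * (2 * modularEnergy p R S) := mul_le_mul_of_nonneg_left (by linarith) hκ0
    _ = _ := by rw [hκ]; ring

/-! ### Periodic odd and even extensions -/

section extensions

variable {f u : ℝ → ℝ}

theorem fract_add_two_div_two (y : ℝ) : Int.fract ((y + 2) / 2) = Int.fract (y / 2) := by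
  rw [add_div, div_self two_ne_zero, Int.fract_add_one]

theorem oddExt_periodic (f : ℝ → ℝ) : Function.Periodic (oddExt f) 2 := fun y => by
  simp only [oddExt, fract_add_two_div_two]

theorem evenExt_periodic (f : ℝ → ℝ) : Function.Periodic (evenExt f) 2 := fun y => by
  simp only [evenExt, fract_add_two_div_two]

theorem two_mul_fract_of_mem {x : ℝ} (hx : x ∈ Icc (0 : ℝ) 1) : 2 * Int.fract (x / 2) = x := by
  rw [Int.fract_eq_self.2 ⟨by linarith [hx.1], by linarith [hx.2]⟩]; ring

theorem evenExt_of_mem {x : ℝ} (hx : x ∈ Icc (0 : ℝ) 1) : evenExt f x = f x := by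
  rw [evenExt, two_mul_fract_of_mem hx, if_pos hx.2]

theorem oddExt_of_mem {x : ℝ} (hx : x ∈ Icc (0 : ℝ) 1) : oddExt f x = f x := by
  rw [oddExt, two_mul_fract_of_mem hx, if_pos hx.2]

/-- The extensions at a point are given, up to a sign, by the value at a point of `[0,1]`. -/
theorem exists_ext_eq (y : ℝ) : ∃ x ∈ Icc (0 : ℝ) 1, (∀ f, evenExt f y = f x) ∧
    ((∀ f, oddExt f y = f x) ∨ ∀ f, oddExt f y = -f x) := by
  have h0 := Int.fract_nonneg (y / 2)
  have h1 := Int.fract_lt_one (y / 2)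
  by_cases h : 2 * Int.fract (y / 2) ≤ 1
  · exact ⟨_, ⟨by linarith, h⟩, fun f => by rw [evenExt, if_pos h],
      Or.inl fun f => by rw [oddExt, if_pos h]⟩
  · exact ⟨2 - 2 * Int.fract (y / 2), ⟨by linarith, by linarith⟩, fun f => by rw [evenExt, if_neg h],
      Or.inr fun f => by rw [oddExt, if_neg h]⟩

theorem two_mul_fract_neg {y : ℝ} (h : Int.fract (y / 2) ≠ 0) :
    2 * Int.fract (-y / 2) = 2 - 2 * Int.fract (y / 2) := by
  rw [neg_div, Int.fract_neg h]; ring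

theorem fract_neg_half_eq_zero {y : ℝ} (h : Int.fract (y / 2) = 0) : Int.fract (-y / 2) = 0 := by
  rw [neg_div, Int.fract_neg_eq_zero, h]

theorem evenExt_neg (f : ℝ → ℝ) (y : ℝ) : evenExt f (-y) = evenExt f y := by
  by_cases h : Int.fract (y / 2) = 0
  · rw [evenExt, evenExt, h, fract_neg_half_eq_zero h]
  · rw [evenExt, evenExt, two_mul_fract_neg h]
    rcases lt_trichotomy (2 * Int.fract (y / 2)) 1 with h1 | h1 | h1
    · rw [if_neg (by linarith), if_pos h1.le, sub_sub_cancel]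
    · rw [h1]; norm_num
    · rw [if_pos (by linarith), if_neg (by linarith)]

theorem oddExt_neg (h0 : f 0 = 0) (h1 : f 1 = 0) (y : ℝ) : oddExt f (-y) = -oddExt f y := by
  by_cases h : Int.fract (y / 2) = 0
  · rw [oddExt, oddExt, h, fract_neg_half_eq_zero h]; simp [h0]
  · rw [oddExt, oddExt, two_mul_fract_neg h]
    rcases lt_trichotomy (2 * Int.fract (y / 2)) 1 with h2 | h2 | h2
    · rw [if_neg (by linarith), if_pos h2.le, sub_sub_cancel]
    · rw [h2]; norm_num [h1]
    · rw [if_pos (by linarith), if_neg (by linarith), neg_neg]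

theorem oddExt_eq_of (hodd : ∀ y, u (-y) = -u y) (hper : Function.Periodic u 2)
    (h : ∀ x ∈ Icc (0 : ℝ) 1, f x = u x) : oddExt f = u := by
  funext y
  have h0 := Int.fract_nonneg (y / 2)
  have h1 := Int.fract_lt_one (y / 2)
  have hy : u (2 * Int.fract (y / 2)) = u y := by
    have := hper.sub_zsmul_eq (x := y) ⌊y / 2⌋
    rw [← this]
    congr 1
    rw [Int.fract, zsmul_eq_mul]; ring
  by_cases h2 : 2 * Int.fract (y / 2) ≤ 1
  · rw [oddExt, if_pos h2, h _ ⟨by linarith, h2⟩, hy]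
  · rw [oddExt, if_neg h2, h _ ⟨by linarith, by linarith⟩, ← hodd, neg_sub, hper.sub_eq, hy]

theorem continuous_evenExt (hf : ContinuousOn f (Icc 0 1)) : Continuous (evenExt f) := by
  -- The extension is a function of `fract (y/2)`, here a folding of `[0,1]` with equal values at
  -- both ends.
  have hk : ContinuousOn (fun r : ℝ => f (min (2 * r) (2 - 2 * r))) (Icc 0 1) := by
    refine hf.comp (by fun_prop) fun r hr => ?_
    refine ⟨le_min (by linarith [hr.1]) (by linarith [hr.2]), ?_⟩
    rcases le_total r (1 / 2) with h | h
    · exact (min_le_left _ _).trans (by linarith)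
    · exact (min_le_right _ _).trans (by linarith)
  have h := (ContinuousOn.comp_fract'' hk (by norm_num)).comp (continuous_id.div_const 2)
  convert h using 1
  funext y
  simp only [evenExt, Function.comp, id]
  split_ifs with h2
  · rw [min_eq_left (by linarith)]
  · rw [min_eq_right (by linarith)]

theorem continuous_oddExt (hf : ContinuousOn f (Icc 0 1)) (h0 : f 0 = 0) (h1 : f 1 = 0) :
    Continuous (oddExt f) := by
  -- On each half of the period one of the two terms is frozen at `f 1 = 0`.
  have hk : ContinuousOn (fun r : ℝ => f (min (2 * r) 1) - f (min (2 - 2 * r) 1)) (Icc 0 1) := by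
    refine (hf.comp (by fun_prop) fun r hr => ?_).sub (hf.comp (by fun_prop) fun r hr => ?_)
    · exact ⟨le_min (by linarith [hr.1]) zero_le_one, min_le_right _ _⟩
    · exact ⟨le_min (by linarith [hr.2]) zero_le_one, min_le_right _ _⟩
  have h := (ContinuousOn.comp_fract'' hk (by norm_num [h0, h1])).comp
    (continuous_id.div_const 2)
  convert h using 1
  funext y
  simp only [oddExt, Function.comp, id]
  split_ifs with h2
  · rw [min_eq_left h2, min_eq_right (by linarith), h1, sub_zero]
  · rw [min_eq_right (by linarith), min_eq_left (by linarith), h1, zero_sub]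

end extensions

/-! ### Sobolev functions on the unit interval -/

instance : IsProbabilityMeasure unitMeasure := ⟨by simp [unitMeasure]⟩

/-- The fundamental theorem of calculus for absolutely continuous functions on `[0,1]`. -/
theorem eq_add_integral_dx {u : ℝ → ℝ} (hu : AbsolutelyContinuousOnInterval u 0 1) {x : ℝ}
    (hx : x ∈ Icc (0 : ℝ) 1) : u x = u 0 + ∫ s in (0 : ℝ)..x, dx u s := by
  have hsub : uIcc 0 x ⊆ uIcc (0 : ℝ) 1 := by
    rw [uIcc_of_le hx.1, uIcc_of_le zero_le_one]; exact Icc_subset_Icc_right hx.2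
  have h := (hu.mono hsub).integral_deriv_eq_sub
  have e : ∫ s in (0 : ℝ)..x, dx u s = ∫ s in (0 : ℝ)..x, deriv u s := by
    have hne : ∀ᵐ s : ℝ, s ≠ 1 := by simp [ae_iff]
    refine intervalIntegral.integral_congr_ae ?_
    filter_upwards [hne] with s hs hs'
    rw [uIoc_of_le hx.1] at hs'
    exact derivWithin_of_mem_nhds (Icc_mem_nhds hs'.1 (lt_of_le_of_ne (hs'.2.trans hx.2) hs))
  rw [e, h]; ring

/-- From `u 0 = 0`, `|u|` is at most the `L¹` norm of the derivative, hence its `L^p` norm on a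
probability space. This turns the essential bound on `z_t` into a uniform pointwise bound. -/
theorem abs_le_of_mem_W10 {p : ℝ} (hp : 1 < p) {u : ℝ → ℝ} {M : ℝ≥0} (hu : u ∈ W10 p)
    (hM : normW1 p u ≤ M) {x : ℝ} (hx : x ∈ Icc (0 : ℝ) 1) : |u x| ≤ M := by
  obtain ⟨⟨hac, hLp⟩, h0, -⟩ := hu
  have hp1 : (1 : ℝ≥0∞) ≤ ENNReal.ofReal p := by simpa using hp.le
  have hint : Integrable (dx u) unitMeasure := hLp.integrable hp1
  have h1 : |u x| ≤ ∫ s, |dx u s| ∂unitMeasure := by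
    have hi : IntegrableOn (fun s => |dx u s|) (Ioc 0 1) := by
      rw [integrableOn_Ioc_iff_integrableOn_Ioo]; exact hint.abs
    rw [eq_add_integral_dx hac hx, h0, zero_add]
    refine (intervalIntegral.abs_integral_le_integral_abs hx.1).trans ?_
    rw [intervalIntegral.integral_of_le hx.1, unitMeasure, ← integral_Ioc_eq_integral_Ioo]
    exact setIntegral_mono_set hi (ae_of_all _ fun _ => abs_nonneg _)
      (Ioc_subset_Ioc_right hx.2).eventuallyLE
  have h2 : ∫ s, |dx u s| ∂unitMeasure = (eLpNorm (dx u) 1 unitMeasure).toReal := by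
    rw [eLpNorm_one_eq_lintegral_enorm]
    simpa [Real.norm_eq_abs] using integral_norm_eq_lintegral_enorm hint.aestronglyMeasurable
  have h3 : eLpNorm (dx u) 1 unitMeasure ≤ M :=
    (eLpNorm_le_eLpNorm_of_exponent_le hp1 hLp.aestronglyMeasurable).trans
      (le_add_self.trans hM)
  rw [h2] at h1
  exact h1.trans (ENNReal.toReal_le_coe_of_le_coe h3)

/-- The odd extension of a function with continuous derivative that vanishes at the end points. -/
theorem hasDerivAt_oddExt {u : ℝ → ℝ} (hu : AbsolutelyContinuousOnInterval u 0 1)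
    (hd : ContinuousOn (dx u) (Icc 0 1)) (h0 : u 0 = 0) (h1 : u 1 = 0) (y : ℝ) :
    HasDerivAt (oddExt u) (evenExt (dx u) y) y := by
  have hc := continuous_evenExt hd
  have hi : ∀ a b, IntervalIntegrable (evenExt (dx u)) volume a b := fun a b =>
    hc.intervalIntegrable a b
  have hodd : ∀ y, ∫ s in (0 : ℝ)..(-y), evenExt (dx u) s
      = -∫ s in (0 : ℝ)..y, evenExt (dx u) s := fun y => by
    have := intervalIntegral.integral_comp_neg (a := 0) (b := y) (evenExt (dx u))
    simp only [evenExt_neg, neg_zero] at this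
    rw [this, intervalIntegral.integral_symm]
  have heq : ∀ x ∈ Icc (0 : ℝ) 1, u x = ∫ s in (0 : ℝ)..x, evenExt (dx u) s := fun x hx => by
    rw [eq_add_integral_dx hu hx, h0, zero_add]
    refine intervalIntegral.integral_congr fun s hs => ?_
    rw [uIcc_of_le hx.1] at hs
    exact (evenExt_of_mem ⟨hs.1, hs.2.trans hx.2⟩).symm
  have hone : ∫ s in (0 : ℝ)..1, evenExt (dx u) s = 0 := by
    rw [← heq 1 (by simp), h1]
  -- The primitive of the even extension is odd, and periodic because its increment over a period is
  -- twice `u 1 - u 0 = 0`.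
  have e : oddExt u = fun y => ∫ s in (0 : ℝ)..y, evenExt (dx u) s := by
    refine oddExt_eq_of hodd (fun y => ?_) heq
    have h2 := (evenExt_periodic (dx u)).intervalIntegral_add_eq y (-1)
    have h3 : ∫ s in (-1 : ℝ)..(-1 + 2), evenExt (dx u) s = 0 := by
      have e2 : (-1 : ℝ) + 2 = 1 := by norm_num
      rw [e2, ← intervalIntegral.integral_add_adjacent_intervals (hi (-1) 0) (hi 0 1), hone,
        intervalIntegral.integral_symm, hodd, hone]
      simp
    have h4 := intervalIntegral.integral_add_adjacent_intervals (hi 0 y) (hi y (y + 2))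
    rw [h2, h3, add_zero] at h4
    exact h4.symm
  rw [e]
  exact intervalIntegral.integral_hasDerivAt_right (hi _ _)
    (hc.stronglyMeasurableAtFilter _ _) hc.continuousAt

/-! ### Differentiating the Duhamel term for a source merely measurable in time -/

/-- A bounded Carathéodory function. -/
structure IsBoundedCaratheodory (w : ℝ → ℝ → ℝ) (B : ℝ) : Prop where
  meas : Measurable (Function.uncurry w)
  cont : ∀ s, Continuous (w s)
  bound : ∀ s y, |w s y| ≤ B

namespace IsBoundedCaratheodory

variable {w : ℝ → ℝ → ℝ} {B : ℝ}

theorem bound_nonneg (hw : IsBoundedCaratheodory w B) : 0 ≤ B :=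
  (abs_nonneg _).trans (hw.bound 0 0)

theorem intervalIntegrable_comp (hw : IsBoundedCaratheodory w B) {α : ℝ → ℝ} (hα : Measurable α)
    (a b : ℝ) : IntervalIntegrable (fun s => w s (α s)) volume a b :=
  (intervalIntegrable_const (c := B)).mono_fun
    (hw.meas.comp (measurable_id.prodMk hα)).aestronglyMeasurable
    (ae_of_all _ fun s => by
      simpa [abs_of_nonneg hw.bound_nonneg] using hw.bound s (α s))

theorem continuous_convolution (hw : IsBoundedCaratheodory w B) :
    Continuous fun q : ℝ × ℝ => ∫ s in (0 : ℝ)..q.1, w s (q.2 - s) := by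
  -- Continuous in the space variable by dominated convergence, and `B`-Lipschitz in time.
  refine continuous_prod_of_continuous_lipschitzWith _ ⟨B, hw.bound_nonneg⟩ (fun t => ?_)
    fun σ => LipschitzWith.of_dist_le_mul fun t t' => ?_
  · refine intervalIntegral.continuous_of_dominated_interval (bound := fun _ => B)
      (fun σ => ?_) (fun σ => ae_of_all _ fun s _ => hw.bound _ _) intervalIntegrable_const
      (ae_of_all _ fun s _ => (hw.cont s).comp (by fun_prop))
    exact (hw.meas.comp (measurable_id.prodMk
      (measurable_const.sub measurable_id))).aestronglyMeasurable
  · have hi := fun a b => hw.intervalIntegrable_comp (α := fun s => σ - s) (by fun_prop) a b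
    rw [Real.dist_eq, Real.dist_eq, intervalIntegral.integral_interval_sub_left (hi _ _) (hi _ _)]
    have := intervalIntegral.norm_integral_le_of_norm_le_const (a := t') (b := t)
      (f := fun s => w s (σ - s)) (C := B) fun s _ => hw.bound _ _
    exact this

theorem hasDerivAt_primitive (hw : IsBoundedCaratheodory w B) (s y : ℝ) :
    HasDerivAt (fun y => ∫ r in (0 : ℝ)..y, w s r) (w s y) y :=
  intervalIntegral.integral_hasDerivAt_right ((hw.cont s).intervalIntegrable _ _)
    ((hw.cont s).stronglyMeasurableAtFilter _ _) (hw.cont s).continuousAt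

theorem abs_primitive_sub_le (hw : IsBoundedCaratheodory w B) (s y y' : ℝ) :
    |(∫ r in (0 : ℝ)..y, w s r) - ∫ r in (0 : ℝ)..y', w s r| ≤ B * |y - y'| := by
  have hi := fun a b => (hw.cont s).intervalIntegrable (μ := volume) a b
  rw [intervalIntegral.integral_interval_sub_left (hi _ _) (hi _ _)]
  exact intervalIntegral.norm_integral_le_of_norm_le_const (f := w s) (C := B)
    fun r _ => hw.bound _ _

theorem measurable_primitive (hw : IsBoundedCaratheodory w B) :
    Measurable (Function.uncurry fun s y : ℝ => ∫ r in (0 : ℝ)..y, w s r) := by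
  refine measurable_uncurry_of_continuous_of_measurable (u := fun y s => ∫ r in (0 : ℝ)..y, w s r)
    (fun s => ?_) (fun y => ?_) |>.comp measurable_swap
  · exact continuous_iff_continuousAt.2 fun y => (hw.hasDerivAt_primitive s y).continuousAt
  · have h := hw.meas.stronglyMeasurable
    simp only [intervalIntegral]
    exact ((h.integral_prod_right (ν := volume.restrict (Ioc 0 y))).sub
      (h.integral_prod_right (ν := volume.restrict (Ioc y 0)))).measurable

theorem intervalIntegrable_primitive_comp (hw : IsBoundedCaratheodory w B) {α : ℝ → ℝ}
    (hα : Continuous α) (a b : ℝ) :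
    IntervalIntegrable (fun s => ∫ r in (0 : ℝ)..(α s), w s r) volume a b := by
  have hc : Continuous fun s => B * |α s| := by fun_prop
  refine (hc.intervalIntegrable a b).mono_fun
    (hw.measurable_primitive.comp (measurable_id.prodMk hα.measurable)).aestronglyMeasurable
    (ae_of_all _ fun s => ?_)
  have h := hw.abs_primitive_sub_le s (α s) 0
  rw [intervalIntegral.integral_same, sub_zero, sub_zero] at h
  exact h.trans (le_abs_self _)

/-- The space primitive is `C¹` and `B`-Lipschitz, so dominated differentiation needs only end
points that are 1-Lipschitz in the parameter and differentiable for almost every `s`. -/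
theorem hasDerivAt_integral_primitive (hw : IsBoundedCaratheodory w B) {α : ℝ → ℝ → ℝ}
    {α' : ℝ → ℝ} {θ₀ T : ℝ} (hα : ∀ θ, Continuous (α θ)) (hα' : Measurable α')
    (hlip : ∀ s θ θ', |α θ s - α θ' s| ≤ |θ - θ'|)
    (hd : ∀ᵐ s, HasDerivAt (fun θ => α θ s) (α' s) θ₀) :
    HasDerivAt (fun θ => ∫ s in (0 : ℝ)..T, ∫ r in (0 : ℝ)..(α θ s), w s r)
      (∫ s in (0 : ℝ)..T, w s (α θ₀ s) * α' s) θ₀ := by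
  refine (intervalIntegral.hasDerivAt_integral_of_dominated_loc_of_lip (s := univ)
    (bound := fun _ => B) Filter.univ_mem
    (.of_forall fun θ => ?_) (hw.intervalIntegrable_primitive_comp (hα θ₀) 0 T) ?_
    (ae_of_all _ fun s _ => ?_) intervalIntegrable_const ?_).2
  · exact (hw.measurable_primitive.comp
      (measurable_id.prodMk (hα θ).measurable)).aestronglyMeasurable
  · exact ((hw.meas.comp
      (measurable_id.prodMk (hα θ₀).measurable)).mul hα').aestronglyMeasurable
  · refine (LipschitzWith.of_dist_le_mul fun θ θ' => ?_).lipschitzOnWith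
    rw [Real.dist_eq, Real.dist_eq, Real.coe_nnabs, abs_of_nonneg hw.bound_nonneg]
    exact (hw.abs_primitive_sub_le s _ _).trans
      (mul_le_mul_of_nonneg_left (hlip s θ θ') hw.bound_nonneg)
  · filter_upwards [hd] with s hs _
    exact (hw.hasDerivAt_primitive s (α θ₀ s)).comp θ₀ hs

/-- The space derivative of the Duhamel term. -/
theorem hasDerivAt_duhamel_space (hw : IsBoundedCaratheodory w B) (t x : ℝ) :
    HasDerivAt (fun x => ∫ s in (0 : ℝ)..t, ∫ y in (x - (t - s))..(x + (t - s)), w s y)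
      ((∫ s in (0 : ℝ)..t, w s (x + t - s)) - ∫ s in (0 : ℝ)..t, w s (x - t + s)) x := by
  have h1 := hw.hasDerivAt_integral_primitive (α := fun x s => x + t - s) (α' := fun _ => 1)
    (θ₀ := x) (T := t) (fun θ => by fun_prop) measurable_const
    (fun s θ θ' => by ring_nf; rfl)
    (ae_of_all _ fun s => ((hasDerivAt_id x).add_const t).sub_const s)
  have h2 := hw.hasDerivAt_integral_primitive (α := fun x s => x - t + s) (α' := fun _ => 1)
    (θ₀ := x) (T := t) (fun θ => by fun_prop) measurable_const
    (fun s θ θ' => by ring_nf; rfl)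
    (ae_of_all _ fun s => ((hasDerivAt_id x).sub_const t).add_const s)
  simp only [mul_one] at h1 h2
  refine (h1.sub h2).congr_of_eventuallyEq (.of_forall fun x => ?_)
  have i1 := hw.intervalIntegrable_primitive_comp (α := fun s => x + t - s) (by fun_prop) 0 t
  have i2 := hw.intervalIntegrable_primitive_comp (α := fun s => x - t + s) (by fun_prop) 0 t
  simp only [Pi.sub_apply]
  rw [← intervalIntegral.integral_sub i1 i2]
  refine intervalIntegral.integral_congr fun s _ => ?_
  have hi := fun a b => (hw.cont s).intervalIntegrable (μ := volume) a b
  have e1 : x + t - s = x + (t - s) := by ring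
  have e2 : x - t + s = x - (t - s) := by ring
  simp only [e1, e2]
  rw [intervalIntegral.integral_interval_sub_left (hi _ _) (hi _ _)]

/-- The time derivative of the Duhamel term. -/
theorem hasDerivWithinAt_duhamel_time (hw : IsBoundedCaratheodory w B) {t : ℝ} (ht : 0 ≤ t)
    (x : ℝ) :
    HasDerivWithinAt (fun t => ∫ s in (0 : ℝ)..t, ∫ y in (x - (t - s))..(x + (t - s)), w s y)
      ((∫ s in (0 : ℝ)..t, w s (x + t - s)) + ∫ s in (0 : ℝ)..t, w s (x - t + s)) (Ici 0) t := by
  -- With `max (θ - s) 0` in place of `θ - s`, the inner integral vanishes for `s > θ`, so the outer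
  -- one runs over the fixed interval `[0, t+1]`. The kink at `s = t` is a null set.
  have hmax : ∀ s θ θ' : ℝ, |max (θ - s) 0 - max (θ' - s) 0| ≤ |θ - θ'| := fun s θ θ' => by
    have := abs_max_sub_max_le_abs (θ - s) (θ' - s) 0
    rwa [sub_sub_sub_cancel_right] at this
  have hα' : Measurable fun s : ℝ => if s ≤ t then (1 : ℝ) else 0 :=
    Measurable.ite measurableSet_Iic measurable_const measurable_const
  have hdm : ∀ᵐ s : ℝ, HasDerivAt (fun θ : ℝ => max (θ - s) 0) (if s ≤ t then 1 else 0) t := by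
    have hne : ∀ᵐ s : ℝ, s ≠ t := by simp [ae_iff]
    filter_upwards [hne] with s hs
    rcases hs.lt_or_gt with h | h
    · rw [if_pos h.le]
      refine ((hasDerivAt_id t).sub_const s).congr_of_eventuallyEq ?_
      filter_upwards [lt_mem_nhds h] with θ hθ
      exact max_eq_left (sub_nonneg.2 hθ.le)
    · rw [if_neg (not_le.2 h)]
      refine (hasDerivAt_const t (0 : ℝ)).congr_of_eventuallyEq ?_
      filter_upwards [gt_mem_nhds h] with θ hθ
      exact max_eq_right (sub_nonpos.2 hθ.le)
  have h1 := hw.hasDerivAt_integral_primitive (α := fun θ s => x + max (θ - s) 0)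
    (θ₀ := t) (T := t + 1) (fun θ => by fun_prop) hα'
    (fun s θ θ' => by rw [add_sub_add_left_eq_sub]; exact hmax s θ θ')
    (hdm.mono fun s hs => hs.const_add x)
  have h2 := hw.hasDerivAt_integral_primitive (α := fun θ s => x - max (θ - s) 0)
    (θ₀ := t) (T := t + 1) (fun θ => by fun_prop) hα'.neg
    (fun s θ θ' => by rw [sub_sub_sub_cancel_left, abs_sub_comm]; exact hmax s θ θ')
    (hdm.mono fun s hs => hs.const_sub x)
  have hval : ∀ β β' : ℝ → ℝ, Measurable β → (∀ s ∈ Icc 0 t, β s = β' s) →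
      ∫ s in (0 : ℝ)..(t + 1), w s (β s) * (if s ≤ t then 1 else 0)
        = ∫ s in (0 : ℝ)..t, w s (β' s) := by
    intro β β' hβ hββ
    have hi : ∀ a b, IntervalIntegrable (fun s => w s (β s) * (if s ≤ t then 1 else 0))
        volume a b := fun a b =>
      (intervalIntegrable_const (c := B)).mono_fun
        ((hw.meas.comp (measurable_id.prodMk hβ)).mul hα').aestronglyMeasurable
        (ae_of_all _ fun s => by
          have := hw.bound s (β s)
          have := hw.bound_nonneg
          dsimp only
          split_ifs
          · simpa [abs_of_nonneg hw.bound_nonneg]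
          · simp)
    rw [← intervalIntegral.integral_add_adjacent_intervals (hi 0 t) (hi t (t + 1))]
    have e1 : ∫ s in t..(t + 1), w s (β s) * (if s ≤ t then 1 else 0) = 0 := by
      refine (intervalIntegral.integral_congr_ae (g := fun _ => (0 : ℝ))
        (ae_of_all _ fun s hs => ?_)).trans (by simp)
      rw [uIoc_of_le (by linarith)] at hs
      rw [if_neg (not_le.2 hs.1), mul_zero]
    rw [e1, add_zero]
    refine intervalIntegral.integral_congr fun s hs => ?_
    rw [uIcc_of_le ht] at hs
    simp only [if_pos hs.2, mul_one, hββ s hs]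
  have hm1 := hval (fun s => x + max (t - s) 0) (fun s => x + t - s) (by fun_prop) fun s hs => by
    rw [max_eq_left (sub_nonneg.2 hs.2)]; ring
  have hm2 := hval (fun s => x - max (t - s) 0) (fun s => x - t + s) (by fun_prop) fun s hs => by
    rw [max_eq_left (sub_nonneg.2 hs.2)]; ring
  have h3 := h1.sub h2
  simp only [Pi.neg_apply, mul_neg, intervalIntegral.integral_neg, sub_neg_eq_add] at h3
  rw [hm1, hm2] at h3
  have heq : ∀ θ ∈ Icc 0 (t + 1),
      ∫ s in (0 : ℝ)..θ, ∫ y in (x - (θ - s))..(x + (θ - s)), w s y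
      = (∫ s in (0 : ℝ)..(t + 1), ∫ r in (0 : ℝ)..(x + max (θ - s) 0), w s r)
        - ∫ s in (0 : ℝ)..(t + 1), ∫ r in (0 : ℝ)..(x - max (θ - s) 0), w s r := by
    intro θ hθ
    have i1 := fun a b => hw.intervalIntegrable_primitive_comp
      (α := fun s => x + max (θ - s) 0) (by fun_prop) a b
    have i2 := fun a b => hw.intervalIntegrable_primitive_comp
      (α := fun s => x - max (θ - s) 0) (by fun_prop) a b
    rw [← intervalIntegral.integral_sub (i1 _ _) (i2 _ _),
      ← intervalIntegral.integral_add_adjacent_intervals ((i1 0 θ).sub (i2 0 θ))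
        ((i1 θ (t + 1)).sub (i2 θ (t + 1)))]
    have e1 : ∫ s in θ..(t + 1), ((∫ r in (0 : ℝ)..(x + max (θ - s) 0), w s r)
        - ∫ r in (0 : ℝ)..(x - max (θ - s) 0), w s r) = 0 := by
      refine (intervalIntegral.integral_congr (g := fun _ => (0 : ℝ)) fun s hs => ?_).trans
        (by simp)
      rw [uIcc_of_le hθ.2] at hs
      simp only [max_eq_right (sub_nonpos.2 hs.1), add_zero, sub_zero, sub_self]
    rw [e1, add_zero]
    refine intervalIntegral.integral_congr fun s hs => ?_
    rw [uIcc_of_le hθ.1] at hs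
    have hi := fun a b => (hw.cont s).intervalIntegrable (μ := volume) a b
    simp only [max_eq_left (sub_nonneg.2 hs.2)]
    rw [intervalIntegral.integral_interval_sub_left (hi _ _) (hi _ _)]
  refine h3.hasDerivWithinAt.congr_of_eventuallyEq ?_ (heq t ⟨ht, by linarith⟩)
  filter_upwards [self_mem_nhdsWithin,
    mem_nhdsWithin_of_mem_nhds (gt_mem_nhds (by linarith : t < t + 1))] with θ h0 h1
  exact heq θ ⟨h0, h1.le⟩

end IsBoundedCaratheodory

/-! ### From strong solutions to the reflected transport equation -/

/-- The odd periodic extension of `z_t` has a bounded Carathéodory representative. -/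
theorem exists_caratheodory_zt {p : ℝ} (hp : 1 < p) {z : ℝ → ℝ → ℝ}
    (hz : MemLinfty (W10 p) (normW1 p) (zt z)) :
    ∃ (v : ℝ → ℝ → ℝ) (B : ℝ), IsBoundedCaratheodory v B ∧ (∀ s y, v s (-y) = -v s y) ∧
      (∀ s, Function.Periodic (v s) 2) ∧
      ∀ᵐ s, 0 < s → ∀ y, v s y = oddExt (zt z s) y := by
  obtain ⟨-, M, hM⟩ := hz
  rw [ae_restrict_iff' measurableSet_Ioi] at hM
  -- A measurable null set containing all bad times; the representative is set to zero there and at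
  -- nonpositive times.
  set N := toMeasurable volume {s | ¬(s ∈ Ioi (0 : ℝ) → zt z s ∈ W10 p ∧ normW1 p (zt z s) ≤ M)}
    with hN
  have hN0 : volume N = 0 := by rw [hN, measure_toMeasurable]; exact hM
  set E := Ioi (0 : ℝ) \ N with hE
  have hEm : MeasurableSet E := measurableSet_Ioi.diff (measurableSet_toMeasurable _ _)
  have hEgood : ∀ s ∈ E, zt z s ∈ W10 p ∧ normW1 p (zt z s) ≤ M := fun s hs => by
    by_contra hcon
    exact hs.2 (subset_toMeasurable _ _ fun hcon' => hcon (hcon' hs.1))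
  have hin : ∀ s ∈ E, ∀ y, E.indicator (fun s => oddExt (zt z s) y) s = oddExt (zt z s) y :=
    fun s hs y => indicator_of_mem hs _
  have hout : ∀ s, s ∉ E → ∀ y, E.indicator (fun s => oddExt (zt z s) y) s = 0 :=
    fun s hs y => indicator_of_notMem hs _
  have hcont : ∀ s, Continuous fun y => E.indicator (fun s => oddExt (zt z s) y) s := by
    intro s
    by_cases hs : s ∈ E
    · simp only [hin s hs]
      obtain ⟨⟨⟨hac, -⟩, h0, h1⟩, -⟩ := hEgood s hs
      have hc := hac.continuousOn
      rw [uIcc_of_le zero_le_one] at hc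
      exact continuous_oddExt hc h0 h1
    · simp only [hout s hs]; exact continuous_const
  have hmeas : ∀ y, Measurable (E.indicator fun s => oddExt (zt z s) y) := by
    intro y
    obtain ⟨x, -, -, hx⟩ := exists_ext_eq y
    -- At positive times `zt` is a genuine derivative in `t`, and `deriv` is always measurable.
    have hd : Measurable (E.indicator (deriv fun s => z s x)) :=
      (measurable_deriv _).indicator hEm
    have hzt : ∀ s ∈ E, zt z s x = deriv (fun s => z s x) s := fun s hs =>
      derivWithin_of_mem_nhds (Ici_mem_nhds hs.1)
    rcases hx with hx | hx
    · convert hd using 1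
      exact indicator_congr fun s hs => by rw [hx, hzt s hs]
    · convert hd.neg using 1
      funext s
      by_cases hs : s ∈ E
      · rw [hin s hs, Pi.neg_apply, indicator_of_mem hs, hx, hzt s hs]
      · rw [hout s hs, Pi.neg_apply, indicator_of_notMem hs, neg_zero]
  refine ⟨fun s y => E.indicator (fun s => oddExt (zt z s) y) s, M,
    ⟨?_, hcont, fun s y => ?_⟩, fun s y => ?_, fun s y => ?_, ?_⟩
  · exact (measurable_uncurry_of_continuous_of_measurable
      (u := fun y s => E.indicator (fun s => oddExt (zt z s) y) s) hcont hmeas).comp measurable_swap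
  · by_cases hs : s ∈ E
    · rw [hin s hs]
      obtain ⟨x, hx, -, hy⟩ := exists_ext_eq y
      have hb := abs_le_of_mem_W10 hp (hEgood s hs).1 (hEgood s hs).2 hx
      rcases hy with hy | hy
      · rwa [hy]
      · rwa [hy, abs_neg]
    · rw [hout s hs, abs_zero]; exact M.2
  · by_cases hs : s ∈ E
    · obtain ⟨⟨-, h0, h1⟩, -⟩ := hEgood s hs
      simp only [hin s hs, oddExt_neg h0 h1]
    · simp only [hout s hs, neg_zero]
  · by_cases hs : s ∈ E
    · simp only [hin s hs, oddExt_periodic (zt z s) y]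
    · simp only [hout s hs]
  · have : ∀ᵐ s, s ∉ N := measure_eq_zero_iff_ae_notMem.1 hN0
    filter_upwards [this] with s hs h0 y
    exact hin s ⟨h0, hs⟩ y

/-- The Riemann invariants of a strong solution are the two halves of a solution of the reflected
transport equation. -/
theorem IsStrongSolution.exists_reflectedTransport {p : ℝ} (hp : 1 < p) {a z₀ z₁ : ℝ → ℝ}
    {z : ℝ → ℝ → ℝ} (hac : ContinuousOn a (Icc 0 1)) (ha : ∀ x ∈ Icc (0 : ℝ) 1, 0 ≤ a x)
    (hY : (z₀, z₁) ∈ Y p) (hz : IsStrongSolution p a z₀ z₁ z) :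
    ∃ R : ℝ → ℝ → ℝ, IsReflectedTransport (evenExt a) R ∧
      ∀ t, 0 ≤ t → ∀ x ∈ Icc (0 : ℝ) 1, rho z t x = R t x ∧ xi z t x = R t (-x) := by
  obtain ⟨⟨⟨⟨hz0ac, -⟩, hdz0ac, -⟩, -, hz00, hz01⟩, ⟨hz1ac, -⟩, hz10, hz11⟩ := hY
  have hdz0 := hdz0ac.continuousOn
  have hz1 := hz1ac.continuousOn
  rw [uIcc_of_le zero_le_one] at hdz0 hz1
  obtain ⟨v, B, hv, hvodd, hvper, hveq⟩ := exists_caratheodory_zt hp hz.memLinfty_zt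
  have hbc : Continuous (evenExt a) := continuous_evenExt hac
  obtain ⟨A, hA⟩ := isCompact_Icc.exists_bound_of_continuousOn hac
  have hbA : ∀ y, |evenExt a y| ≤ A := fun y => by
    obtain ⟨x, hx, hy, -⟩ := exists_ext_eq y
    rw [hy]; exact hA x hx
  set w : ℝ → ℝ → ℝ := fun s y => -(evenExt a y * v s y) with hw_def
  have hw : IsBoundedCaratheodory w (A * B) :=
    { meas := ((hbc.measurable.comp measurable_snd).mul hv.meas).neg
      cont := fun s => (hbc.mul (hv.cont s)).neg
      bound := fun s y => by
        rw [hw_def, abs_neg, abs_mul]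
        exact mul_le_mul (hbA y) (hv.bound s y) (abs_nonneg _) ((abs_nonneg _).trans (hbA y)) }
  have hwodd : ∀ s y, w s (-y) = -w s y := fun s y => by
    simp only [hw_def, hvodd, evenExt_neg]; ring
  have hwper : ∀ s, Function.Periodic (w s) 2 := fun s y => by
    simp only [hw_def, hvper s y, evenExt_periodic a y]
  have hweq : ∀ᵐ s, 0 < s → ∀ y, -(evenExt a y * oddExt (zt z s) y) = w s y := by
    filter_upwards [hveq] with s hs h0 y
    rw [hw_def, ← hs h0]
  have hec := continuous_evenExt hdz0
  have hoc := continuous_oddExt hz1 hz10 hz11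
  have hz0d := hasDerivAt_oddExt hz0ac hdz0 hz00 hz01
  have hz1i : ∀ a b, IntervalIntegrable (oddExt z₁) volume a b := fun a b =>
    hoc.intervalIntegrable a b
  have hz1p : ∀ y, HasDerivAt (fun y => ∫ s in (0 : ℝ)..y, oddExt z₁ s) (oddExt z₁ y) y := fun y =>
    intervalIntegral.integral_hasDerivAt_right (hz1i _ _) (hoc.stronglyMeasurableAtFilter _ _)
      hoc.continuousAt
  have hz1sub : ∀ x t, ∫ y in (x - t)..(x + t), oddExt z₁ y
      = (∫ s in (0 : ℝ)..(x + t), oddExt z₁ s) - ∫ s in (0 : ℝ)..(x - t), oddExt z₁ s :=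
    fun x t => (intervalIntegral.integral_interval_sub_left (hz1i _ _) (hz1i _ _)).symm
  have hformula : ∀ t ∈ Ici (0 : ℝ), ∀ x ∈ Icc (0 : ℝ) 1,
      z t x = (1 / 2) * (oddExt z₀ (x + t) + oddExt z₀ (x - t))
        + (1 / 2) * ((∫ s in (0 : ℝ)..(x + t), oddExt z₁ s) - ∫ s in (0 : ℝ)..(x - t), oddExt z₁ s)
        + (1 / 2) * ∫ s in (0 : ℝ)..t, ∫ y in (x - (t - s))..(x + (t - s)), w s y := by
    intro t ht x hx
    rw [hz.formula t ht x hx, hz1sub]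
    congr 2
    refine intervalIntegral.integral_congr_ae ?_
    filter_upwards [hweq] with s hs hst
    rw [uIoc_of_le ht] at hst
    simp only [hs hst.1]
  set F : ℝ → ℝ := fun y => evenExt (dx z₀) y + oddExt z₁ y with hF_def
  have hFc : Continuous F := hec.add hoc
  -- The explicit transport solution with initial value `z₀' + z₁`, suitably extended, and source
  -- `w`, the representative of `-ã z̃_t`.
  set R : ℝ → ℝ → ℝ := fun t y => F (y + t) + ∫ s in (0 : ℝ)..t, w s (y + t - s) with hR_def
  have hRneg : ∀ t x, R t (-x) = evenExt (dx z₀) (x - t) - oddExt z₁ (x - t)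
      - ∫ s in (0 : ℝ)..t, w s (x - t + s) := by
    intro t x
    have e : -x + t = -(x - t) := by ring
    have e2 : ∫ s in (0 : ℝ)..t, w s (-x + t - s) = -∫ s in (0 : ℝ)..t, w s (x - t + s) := by
      rw [← intervalIntegral.integral_neg]
      refine intervalIntegral.integral_congr fun s _ => ?_
      have e3 : -x + t - s = -(x - t + s) := by ring
      simp only [e3, hwodd]
    simp only [hR_def, hF_def]
    rw [e2, e, evenExt_neg, oddExt_neg hz10 hz11]
    ring
  have hzx : ∀ t, 0 ≤ t → ∀ x ∈ Icc (0 : ℝ) 1, zx z t x = (R t x + R t (-x)) / 2 := by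
    intro t ht x hx
    have hd : HasDerivAt (fun x => (1 / 2) * (oddExt z₀ (x + t) + oddExt z₀ (x - t))
        + (1 / 2) * ((∫ s in (0 : ℝ)..(x + t), oddExt z₁ s) - ∫ s in (0 : ℝ)..(x - t), oddExt z₁ s)
        + (1 / 2) * ∫ s in (0 : ℝ)..t, ∫ y in (x - (t - s))..(x + (t - s)), w s y)
        ((1 / 2) * (evenExt (dx z₀) (x + t) + evenExt (dx z₀) (x - t))
        + (1 / 2) * (oddExt z₁ (x + t) - oddExt z₁ (x - t))
        + (1 / 2) * ((∫ s in (0 : ℝ)..t, w s (x + t - s))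
          - ∫ s in (0 : ℝ)..t, w s (x - t + s))) x :=
      (((((hz0d _).comp_add_const x t).add ((hz0d _).comp_sub_const x t)).const_mul (1 / 2)).add
        ((((hz1p _).comp_add_const x t).sub ((hz1p _).comp_sub_const x t)).const_mul (1 / 2))).add
        ((hw.hasDerivAt_duhamel_space t x).const_mul (1 / 2))
    have hd2 := hd.hasDerivWithinAt (s := Icc 0 1) |>.congr (fun y hy => hformula t ht y hy)
      (hformula t ht x hx)
    rw [zx, dx, hd2.derivWithin (uniqueDiffOn_Icc_zero_one x hx), hRneg]
    simp only [hR_def, hF_def]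
    ring
  have hzt : ∀ t, 0 ≤ t → ∀ x ∈ Icc (0 : ℝ) 1, zt z t x = (R t x - R t (-x)) / 2 := by
    intro t ht x hx
    have hp' : ∀ {f : ℝ → ℝ} {f' : ℝ}, HasDerivAt f f' (x + t) →
        HasDerivAt (fun t => f (x + t)) f' t := fun hf => hf.comp_const_add x t
    have hm' : ∀ {f : ℝ → ℝ} {f' : ℝ}, HasDerivAt f f' (x - t) →
        HasDerivAt (fun t => f (x - t)) (-f') t := fun hf => hf.comp_const_sub x t
    have hd : HasDerivWithinAt (fun t => (1 / 2) * (oddExt z₀ (x + t) + oddExt z₀ (x - t))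
        + (1 / 2) * ((∫ s in (0 : ℝ)..(x + t), oddExt z₁ s) - ∫ s in (0 : ℝ)..(x - t), oddExt z₁ s)
        + (1 / 2) * ∫ s in (0 : ℝ)..t, ∫ y in (x - (t - s))..(x + (t - s)), w s y)
        ((1 / 2) * (evenExt (dx z₀) (x + t) + -evenExt (dx z₀) (x - t))
        + (1 / 2) * (oddExt z₁ (x + t) - -oddExt z₁ (x - t))
        + (1 / 2) * ((∫ s in (0 : ℝ)..t, w s (x + t - s))
          + ∫ s in (0 : ℝ)..t, w s (x - t + s))) (Ici 0) t :=
      ((((hp' (hz0d _)).add (hm' (hz0d _))).const_mul (1 / 2)).add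
        (((hp' (hz1p _)).sub (hm' (hz1p _))).const_mul (1 / 2))).hasDerivWithinAt.add
        ((hw.hasDerivWithinAt_duhamel_time ht x).const_mul (1 / 2))
    have hd2 := hd.congr (fun s hs => hformula s hs x hx) (hformula t ht x hx)
    rw [zt, hd2.derivWithin (uniqueDiffOn_Ici 0 t ht), hRneg]
    simp only [hR_def, hF_def]
    ring
  have hRper : ∀ t, Function.Periodic (R t) 2 := fun t y => by
    have e : ∀ s, y + t + 2 - s = y + t - s + 2 := fun s => by ring
    simp only [hR_def, hF_def, e, hwper _ _, add_right_comm y 2 t,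
      evenExt_periodic _ (y + t), oddExt_periodic _ (y + t)]
  -- This closes the loop: the extension of `z_t` is recovered from `R`, so `w` coincides with `src`
  -- for almost every positive time.
  have hoddzt : ∀ t, 0 ≤ t → ∀ y, oddExt (zt z t) y = (R t y - R t (-y)) / 2 := by
    intro t ht y
    have := oddExt_eq_of (f := zt z t) (u := fun y => (R t y - R t (-y)) / 2)
      (fun y => by simp only [neg_neg]; ring)
      (fun y => by
        have e : -(y + 2) = -y - 2 := by ring
        simp only [hRper t y, e, (hRper t).sub_eq]) (hzt t ht)
    rw [this]
  have hRw : ∀ t σ, R t (σ - t) = F σ + ∫ s in (0 : ℝ)..t, w s (σ - s) := fun t σ => by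
    simp only [hR_def, sub_add_cancel]
  have hR0 : ∀ y, R 0 y = F y := fun y => by simp [hR_def]
  refine ⟨R, ⟨hbc, fun y => ?_, evenExt_neg a, evenExt_periodic a, ?_, hRper, fun t ht σ => ?_, ?_⟩,
    fun t ht x hx => ⟨?_, ?_⟩⟩
  · obtain ⟨x, hx, hy, -⟩ := exists_ext_eq y
    rw [hy]; exact ha x hx
  · exact (hFc.comp (by fun_prop : Continuous fun q : ℝ × ℝ => q.2 + q.1)).add
      (hw.continuous_convolution.comp
        (by fun_prop : Continuous fun q : ℝ × ℝ => (q.1, q.2 + q.1)))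
  · rw [hRw, hR0]
    congr 1
    refine intervalIntegral.integral_congr_ae ?_
    filter_upwards [hveq] with s hs hst
    rw [uIoc_of_le ht] at hst
    simp only [hw_def, src, hs hst.1, hoddzt s hst.1.le]
    ring
  · simp only [hR0, hF_def]
    -- The integrand is the derivative of `oddExt z₀`, which vanishes at both ends.
    have h1 : ∫ y in (-1 : ℝ)..1, evenExt (dx z₀) y = 0 := by
      rw [intervalIntegral.integral_eq_sub_of_hasDerivAt (fun y _ => hz0d y)
        (hec.intervalIntegrable _ _), oddExt_neg hz00 hz01, oddExt_of_mem (by simp), hz01]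
      simp
    have h2 : ∫ y in (-1 : ℝ)..1, oddExt z₁ y = 0 := by
      have := integral_symm_neg (oddExt z₁)
      simp only [oddExt_neg hz10 hz11, intervalIntegral.integral_neg] at this
      linarith
    rw [intervalIntegral.integral_add (hec.intervalIntegrable _ _) (hz1i _ _), h1, h2, add_zero]
  · rw [rho, hzx t ht x hx, hzt t ht x hx]; ring
  · rw [xi, hzx t ht x hx, hzt t ht x hx]; ring

end

end DampedWave

/-! ### The proposition -/

/-- `Cp` depends only on `p`; `C` depends only on the upper bound `A` of `a`, on its lower bound
`a₀` on `[c,d]` and on `[c,d]`. -/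
theorem proposition4p4 :
    ∃ Cp : ℝ → ℝ, (∀ p ∈ Ioo (1 : ℝ) 2, 0 < Cp p) ∧
      ∀ A a₀ c d : ℝ, ∃ C : ℝ, 0 < C ∧
        ∀ a : ℝ → ℝ, DampedWave.HypH1 a a₀ c d → (∀ x ∈ Icc (0 : ℝ) 1, a x ≤ A) →
        ∀ p ∈ Ioo (1 : ℝ) 2, ∀ z₀ z₁ : ℝ → ℝ, (z₀, z₁) ∈ DampedWave.Y p →
        ∀ z : ℝ → ℝ → ℝ, DampedWave.IsStrongSolution p a z₀ z₁ z →
        DampedWave.energy p z 0 ≤ 1 →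
          (∀ t, 0 ≤ t → IntervalIntegrable
            (fun x => DampedWave.G p (DampedWave.rho z t x) + DampedWave.G p (DampedWave.xi z t x))
            volume 0 1) ∧
          ∀ S T : ℝ, 0 ≤ S → S ≤ T →
            IntervalIntegrable (DampedWave.modEnergy p z) volume S T ∧
            ∫ t in S..T, DampedWave.modEnergy p z t ≤ C * Cp p * DampedWave.modEnergy p z S := by
  refine ⟨fun p => 1 / (p - 1), fun p hp => one_div_pos.2 (by linarith [hp.1]), ?_⟩
  intro A a₀ c d
  -- The constant is chosen before `a`; for degenerate parameters no `a` is admissible.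
  by_cases hpos : 0 < a₀ ∧ c < d
  swap
  · exact ⟨1, one_pos, fun a ha => absurd ⟨ha.a₀_pos, ha.c_lt_d⟩ hpos⟩
  obtain ⟨C, hC, hmain⟩ := DampedWave.exists_integral_modularEnergy_const (le_max_right A 1)
    hpos.1 (sub_pos.2 hpos.2)
  refine ⟨C, hC, fun a ha hA p hp z₀ z₁ hY z hz _ => ?_⟩
  obtain ⟨R, hR, hRz⟩ := hz.exists_reflectedTransport hp.1 ha.continuousOn ha.nonneg hY
  have hG := DampedWave.continuous_G (p := p) (by linarith [hp.1])
  have hRc : ∀ t, Continuous fun x => DampedWave.G p (R t x) := fun t =>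
    hG.comp (hR.cont_comp continuous_const continuous_id)
  have hRc' : ∀ t, Continuous fun x => DampedWave.G p (R t (-x)) := fun t =>
    (hRc t).comp continuous_neg
  have hint : ∀ t, EqOn (fun x => DampedWave.G p (R t x) + DampedWave.G p (R t (-x)))
      (fun x => DampedWave.G p (DampedWave.rho z t x) + DampedWave.G p (DampedWave.xi z t x))
      (uIcc 0 1) ∨ t < 0 := by
    intro t
    refine (le_or_gt 0 t).imp_left fun ht x hx => ?_
    rw [uIcc_of_le zero_le_one] at hx
    simp only [(hRz t ht x hx).1, (hRz t ht x hx).2]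
  -- The ξ part over `[0,1]` is the integral of `G p (R t x)` over `[-1,0]`.
  have hE : ∀ t, 0 ≤ t → DampedWave.modEnergy p z t = DampedWave.modularEnergy p R t := by
    intro t ht
    rw [DampedWave.modEnergy,
      ← intervalIntegral.integral_congr ((hint t).resolve_right (not_lt.2 ht)),
      intervalIntegral.integral_add ((hRc t).intervalIntegrable _ _)
        ((hRc' t).intervalIntegrable _ _),
      intervalIntegral.integral_comp_neg fun x => DampedWave.G p (R t x), neg_zero, add_comm]
    exact intervalIntegral.integral_add_adjacent_intervals ((hRc t).intervalIntegrable _ _)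
      ((hRc t).intervalIntegrable _ _)
  refine ⟨fun t ht => ?_, fun S T hS hST => ?_⟩
  · refine (((hRc t).add (hRc' t)).intervalIntegrable (μ := volume) 0 1).congr ?_
    exact fun x hx => (hint t).resolve_right (not_lt.2 ht) (uIoc_subset_uIcc hx)
  · have heq : EqOn (DampedWave.modularEnergy p R) (DampedWave.modEnergy p z) (uIcc S T) := by
      intro t ht
      rw [uIcc_of_le hST] at ht
      exact (hE t (hS.trans ht.1)).symm
    refine ⟨((hR.continuous_modularEnergy hp.1).intervalIntegrable S T).congr
      fun t ht => heq (uIoc_subset_uIcc ht), ?_⟩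
    rw [← intervalIntegral.integral_congr heq, hE S hS]
    refine hmain _ R hR (fun y => ?_) c ha.c_nonneg (by linarith [ha.d_le_one])
      (fun x hx => ?_) p hp S T hS hST
    · obtain ⟨x, hx, hy, -⟩ := DampedWave.exists_ext_eq y
      rw [hy]; exact (hA x hx).trans (le_max_left _ _)
    · rw [add_sub_cancel] at hx
      rw [DampedWave.evenExt_of_mem ⟨ha.c_nonneg.trans hx.1, hx.2.trans ha.d_le_one⟩]
      exact ha.lower_bound x hx
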